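/- Let $d\in\{2,3\}$, $0<\delta<1$ and $0<a_{\min}\le a_{\max}$. There is a constant $C_2>0$ depending only on $a_{\min}$, $a_{\max}$, the dimension $d$ and the mesh regularity parameter $\delta$ such that the following holds. *Setting.* Let $D\subset\mathbb R^d$ be a nonempty bounded convex open polygonal/polyhedral domain. Let $\mathcal T_H$ be a conforming triangulation of $\overline D$ by simplices, each of which has diameter at most $H$ and contains a ball of radius $\delta H$ (coarse mesh, $H>0$), and let $\mathcal T_h$ be a conforming triangulation of $\overline D$ (fine mesh). Let $V_h\subset H_0^1(D)$ be the space of continuous functions on $\overline D$ that are affine on each element of $\mathcal T_h$ and vanish on $\partial D$; let $\varphi_i$ be the continuous piecewise linear nodal basis functions of $\mathcal T_H$ at the interior vertices $x_i$, $1\le i\le N_x$: $\varphi_i(x_j)=\delta_{ij}$, $\varphi_i=0$ on $\partial D$. Let $(\Omega,\mathfrak F,P)$ be a probability space, $\xi_1,\dots,\xi_r$ i.i.d. real random variables on it with law $\rho$, $(\mathrm H_n)_{n\ge 0}$ polynomials with $\deg \mathrm H_n=n$ that are orthonormal with respect to $\rho$, $\mathbf H_\alpha(\xi)=\prod_{i=1}^r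 \mathrm H_{\alpha_i}(\xi_i)$ for $\alpha\in\mathbb N^r$, and let $\mathfrak J\subset\mathbb N^r$ be a finite index set (for example $\{\alpha: |\alpha|\le p\}$). Let $a(x,\omega)=a(x,\xi(\omega))$ be a (jointly measurable) random coefficient with $a(x,\omega)\in[a_{\min},a_{\max}]$ for all $x\in D$, almost surely, and let $f\in L^2(D)$. Put $$W_h=\operatorname{span}\{v\,\mathbf H_\alpha(\xi): v\in V_h,\ \alpha\in\mathfrak J\},\qquad (u,v)_a=\mathbb E\int_D a\,\nabla u\cdot\nabla v\,dx,\qquad \|u\|_{(a,H_0^1(D)\otimes L^2(\Omega))}=(u,u)_a^{1/2}.$$ *Multiscale basis.* For $1\le i\le N_x$ and $k\in\mathfrak J$ let $\psi_{i,k}$ be a minimizer of $\|\psi\|_{(a,H_0^1(D)\otimes L^2(\Omega))}$ among all $\psi\in W_h$ with $\mathbb E\int_D\psi\,\varphi_j\,\mathbf H_l(\xi)\,dx=\delta_{ij}\delta_{kl}$ for all $1\le j\le N_x$, $l\in\mathfrak J$, and let $W_H=\operatorname{span}\{\psi_{i,k}\}$. *Claim.* Let $u_h^{gPC}\in W_h$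 and $u_H^{gPC}\in W_H$ be the gPC Galerkin solutions of $-\nabla\cdot(a\nabla u)=f$ in $D$, $u=0$ on $\partial D$, i.e. $$(u_h^{gPC},v)_a=\mathbb E\int_D f v\,dx\ \ \forall v\in W_h,\qquad (u_H^{gPC},v)_a=\mathbb E\int_D f v\,dx\ \ \forall v\in W_H.$$ Then $$\|u_h^{gPC}-u_H^{gPC}\|_{(a,H_0^1(D)\otimes L^2(\Omega))}\le C_2\,H\,\|f\|_{L^2(D)}.$$ -/

import Mathlib

open MeasureTheory ProbabilityTheory Geometry

noncomputable section

/-! ### Meshes and piecewise linear finite elements -/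

/-- `K` is a conforming triangulation of the domain `D ⊆ ℝᵈ`: finitely many simplices, glued along
common faces, all maximal ones (the elements) being `d`-dimensional, that cover `closure D`. -/
structure IsTriangulation {d : ℕ} (D : Set (EuclideanSpace ℝ (Fin d)))
    (K : SimplicialComplex ℝ (EuclideanSpace ℝ (Fin d))) : Prop where
  finite_faces : K.faces.Finite
  card_facet : ∀ s ∈ K.facets, s.card = d + 1
  space_eq : K.space = closure D

/-- The mesh `K` is regular of mesh size `H` with parameter `δ`: each element has diameter at most
`H` and contains a ball of radius `δ * H`. -/
def IsRegularMesh {d : ℕ} (K : SimplicialComplex ℝ (EuclideanSpace ℝ (Fin d))) (δ H : ℝ) : Prop :=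
  ∀ s ∈ K.facets, Metric.diam (convexHull ℝ (s : Set (EuclideanSpace ℝ (Fin d)))) ≤ H ∧
    ∃ y : EuclideanSpace ℝ (Fin d),
      Metric.closedBall y (δ * H) ⊆ convexHull ℝ (s : Set (EuclideanSpace ℝ (Fin d)))

/-- The continuous piecewise linear finite element space of the mesh `K` with zero boundary values
on `D` (the span of the nodal basis functions at the vertices of `K` in `D`). Its elements are
extended by zero outside `D`. -/
def feSpace {d : ℕ} (D : Set (EuclideanSpace ℝ (Fin d)))
    (K : SimplicialComplex ℝ (EuclideanSpace ℝ (Fin d))) :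
    Submodule ℝ (EuclideanSpace ℝ (Fin d) → ℝ) where
  carrier := {v | Continuous v ∧ (∀ x, x ∉ D → v x = 0) ∧
    ∀ s ∈ K.facets, ∃ g : EuclideanSpace ℝ (Fin d) →ᵃ[ℝ] ℝ,
      ∀ x ∈ convexHull ℝ (s : Set (EuclideanSpace ℝ (Fin d))), v x = g x}
  zero_mem' := ⟨continuous_const, fun _ _ => rfl, fun _ _ => ⟨0, fun _ _ => rfl⟩⟩
  add_mem' := by
    rintro v w ⟨hv, hv0, hvK⟩ ⟨hw, hw0, hwK⟩
    refine ⟨hv.add hw, fun x hx => by simp [hv0 x hx, hw0 x hx], fun s hs => ?_⟩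
    obtain ⟨g, hg⟩ := hvK s hs
    obtain ⟨k, hk⟩ := hwK s hs
    exact ⟨g + k, fun x hx => by simp [hg x hx, hk x hx]⟩
  smul_mem' := by
    rintro c v ⟨hv, hv0, hvK⟩
    refine ⟨hv.const_smul c, fun x hx => by simp [hv0 x hx], fun s hs => ?_⟩
    obtain ⟨g, hg⟩ := hvK s hs
    exact ⟨c • g, fun x hx => by simp [hg x hx]⟩

/-- The interior vertices of the mesh. -/
abbrev InteriorVertex {d : ℕ} (D : Set (EuclideanSpace ℝ (Fin d)))
    (K : SimplicialComplex ℝ (EuclideanSpace ℝ (Fin d))) : Type :=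
  {x : EuclideanSpace ℝ (Fin d) // x ∈ K.vertices ∧ x ∈ D}

open Classical in
/-- `φ i` is the nodal basis function of the interior vertex `i`: the (unique) element of the finite
element space with `φ i (j) = δ_ij` at all interior vertices `j`. -/
def IsNodalBasis {d : ℕ} (D : Set (EuclideanSpace ℝ (Fin d)))
    (K : SimplicialComplex ℝ (EuclideanSpace ℝ (Fin d)))
    (φ : InteriorVertex D K → EuclideanSpace ℝ (Fin d) → ℝ) : Prop :=
  ∀ i, φ i ∈ feSpace D K ∧ ∀ j : InteriorVertex D K, φ i j = if i = j then 1 else 0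

/-! ### Polynomial chaos -/

/-- `Q 0, Q 1, Q 2, …` are orthonormal polynomials for the law `ρ`, with `Q n` of degree `n`. -/
def IsOrthonormalPolynomials (ρ : Measure ℝ) (Q : ℕ → Polynomial ℝ) : Prop :=
  (∀ n, (Q n).natDegree = n) ∧
    ∀ m n, ∫ t, (Q m).eval t * (Q n).eval t ∂ρ = if m = n then 1 else 0

/-- The tensorized random polynomial `H_α(ξ(ω)) = ∏ i, Q_{α i}(ξ i (ω))`. -/
def chaosPoly {r : ℕ} {Ω : Type*} (Q : ℕ → Polynomial ℝ) (ξ : Fin r → Ω → ℝ) (α : Fin r → ℕ) :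
    Ω → ℝ :=
  fun ω => ∏ i, (Q (α i)).eval (ξ i ω)

/-- The tensor product of a finite element space `V` with the span of the chaos polynomials with
index in the finite set `J`. -/
def gpcSpace {r d : ℕ} {Ω : Type*} (V : Submodule ℝ (EuclideanSpace ℝ (Fin d) → ℝ))
    (Q : ℕ → Polynomial ℝ) (ξ : Fin r → Ω → ℝ) (J : Finset (Fin r → ℕ)) :
    Submodule ℝ (EuclideanSpace ℝ (Fin d) → Ω → ℝ) :=
  Submodule.span ℝ {u | ∃ v ∈ V, ∃ α ∈ J, u = fun x ω => v x * chaosPoly Q ξ α ω}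

/-! ### The variational problem

All functions `u` below are finite sums of products of a continuous piecewise linear function of `x`
and a function of `ω`, so that the weak gradient in `x` is the classical one, which exists for
almost every `x`. -/

/-- The inner product `E ∫_D u v dx`. -/
def l2Form {d : ℕ} {Ω : Type*} [MeasurableSpace Ω] (P : Measure Ω)
    (D : Set (EuclideanSpace ℝ (Fin d))) (u v : EuclideanSpace ℝ (Fin d) → Ω → ℝ) : ℝ :=
  ∫ ω, (∫ x in D, u x ω * v x ω) ∂P

/-- The energy form `E ∫_D a ∇u · ∇v dx`. -/
def energyForm {d : ℕ} {Ω : Type*} [MeasurableSpace Ω] (P : Measure Ω)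
    (D : Set (EuclideanSpace ℝ (Fin d))) (a u v : EuclideanSpace ℝ (Fin d) → Ω → ℝ) : ℝ :=
  ∫ ω, (∫ x in D,
    a x ω * inner ℝ (gradient (fun y => u y ω) x) (gradient (fun y => v y ω) x)) ∂P

/-- The energy norm `(E ∫_D a |∇u|² dx)^{1/2}`. -/
def energyNorm {d : ℕ} {Ω : Type*} [MeasurableSpace Ω] (P : Measure Ω)
    (D : Set (EuclideanSpace ℝ (Fin d))) (a u : EuclideanSpace ℝ (Fin d) → Ω → ℝ) : ℝ :=
  Real.sqrt (∫ ω, (∫ x in D, a x ω * ‖gradient (fun y => u y ω) x‖ ^ 2) ∂P)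

/-- `u` is the Galerkin solution, in the trial and test space `W`, of `-∇·(a ∇u) = f` in `D`,
`u = 0` on `∂D`. -/
def IsGalerkinSolution {d : ℕ} {Ω : Type*} [MeasurableSpace Ω] (P : Measure Ω)
    (D : Set (EuclideanSpace ℝ (Fin d))) (a : EuclideanSpace ℝ (Fin d) → Ω → ℝ)
    (f : EuclideanSpace ℝ (Fin d) → ℝ) (W : Submodule ℝ (EuclideanSpace ℝ (Fin d) → Ω → ℝ))
    (u : EuclideanSpace ℝ (Fin d) → Ω → ℝ) : Prop :=
  u ∈ W ∧ ∀ w ∈ W, energyForm P D a u w = l2Form P D (fun x _ => f x) w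

open Classical in
/-- The admissible set of the optimization problem for the multiscale basis function with indices
`(i, k)`: all `χ` in the discrete space `W` with `E ∫_D χ φ_j H_l(ξ) dx = δ_ij δ_kl` for all
interior vertices `j` of the coarse mesh and all `l ∈ J`. -/
def msFeasible {r d : ℕ} {Ω : Type*} [MeasurableSpace Ω] (P : Measure Ω)
    (D : Set (EuclideanSpace ℝ (Fin d))) (W : Submodule ℝ (EuclideanSpace ℝ (Fin d) → Ω → ℝ))
    (TH : SimplicialComplex ℝ (EuclideanSpace ℝ (Fin d)))
    (φ : InteriorVertex D TH → EuclideanSpace ℝ (Fin d) → ℝ)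
    (Q : ℕ → Polynomial ℝ) (ξ : Fin r → Ω → ℝ) (J : Finset (Fin r → ℕ))
    (i : InteriorVertex D TH) (k : J) : Set (EuclideanSpace ℝ (Fin d) → Ω → ℝ) :=
  {χ | χ ∈ W ∧ ∀ (j : InteriorVertex D TH) (l : J),
    l2Form P D χ (fun x ω => φ j x * chaosPoly Q ξ l ω) = if i = j ∧ k = l then 1 else 0}

/-- `ψ` is the family of multiscale basis functions: each `ψ i k` minimizes the energy norm over the
admissible set with indices `(i, k)`. -/
def IsMultiscaleBasis {r d : ℕ} {Ω : Type*} [MeasurableSpace Ω] (P : Measure Ω)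
    (D : Set (EuclideanSpace ℝ (Fin d))) (a : EuclideanSpace ℝ (Fin d) → Ω → ℝ)
    (W : Submodule ℝ (EuclideanSpace ℝ (Fin d) → Ω → ℝ))
    (TH : SimplicialComplex ℝ (EuclideanSpace ℝ (Fin d)))
    (φ : InteriorVertex D TH → EuclideanSpace ℝ (Fin d) → ℝ)
    (Q : ℕ → Polynomial ℝ) (ξ : Fin r → Ω → ℝ) (J : Finset (Fin r → ℕ))
    (ψ : InteriorVertex D TH → J → EuclideanSpace ℝ (Fin d) → Ω → ℝ) : Prop :=
  ∀ i k, ψ i k ∈ msFeasible P D W TH φ Q ξ J i k ∧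
    IsMinOn (energyNorm P D a) (msFeasible P D W TH φ Q ξ J i k) (ψ i k)

/-- The space spanned by the multiscale basis functions. -/
def msSpace {r d : ℕ} {Ω : Type*} {D : Set (EuclideanSpace ℝ (Fin d))}
    {TH : SimplicialComplex ℝ (EuclideanSpace ℝ (Fin d))} {J : Finset (Fin r → ℕ)}
    (ψ : InteriorVertex D TH → J → EuclideanSpace ℝ (Fin d) → Ω → ℝ) :
    Submodule ℝ (EuclideanSpace ℝ (Fin d) → Ω → ℝ) :=
  Submodule.span ℝ {u | ∃ i k, u = ψ i k}

end

/-! Let `N` be the kernel of the constraints in the gPC space. First-order optimality makes every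
multiscale basis function energy-orthogonal to `N`. Let `e` be the Galerkin error and `z` the
combination of basis functions with the same constraint values as `e`. Then `e - z` lies in `N`, and
Galerkin orthogonality gives that the energies of `e` and of `e - z` both equal the load functional
at `e - z`. It therefore suffices to bound the load functional on `N` by `O(H)` times the energy
norm (`galerkin_error_le_of_constrained_minimizers`).

On `N` the constraints hold only in the mean over `ω`. Since the chaos polynomials are orthonormal
and the trial functions use only indices in `J`, the pairing of a trial function with `φ j` is, at
each `ω`, a combination of chaos polynomials whose coefficients are exactly the constraint values
(`integral_mul_eq_sum_l2Form`). So each path of an element of `N` is `L²(D)`-orthogonal to the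
coarse finite element space.

Such a path `v` satisfies a Poincaré inequality at scale `H`
(`integral_sq_le_of_orthogonal_nodalBasis`): by orthogonality its `L²` norm is at most its distance
to any coarse function, and a quasi-interpolant is `O(H)` close. Its nodal values are averages of
`v` over balls of radius `H`, or zero at boundary vertices, where convexity puts at least half of
the ball outside `D`. The error at `x` is then controlled by differences `v (x + h) - v x` with `‖h‖
≤ 2 * H`, hence by the gradient (`lintegral_enorm_translate_sub_sq_le`). -/

/-! ### Lipschitz continuity of piecewise Lipschitz functions -/

/-- Induction on the number of sets. Between the first and the last point of `C i` in `[a, b]` the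
bound on `C i` applies directly, even if the path leaves `C i` in between; the two outer pieces are
covered by the remaining sets. -/
theorem abs_sub_le_of_finite_closed_cover {ι : Type*} (s : Finset ι) (C : ι → Set ℝ)
    (hC : ∀ i ∈ s, IsClosed (C i)) (g : ℝ → ℝ) (L : ℝ)
    (hL : ∀ i ∈ s, ∀ x ∈ C i, ∀ y ∈ C i, x ≤ y → |g y - g x| ≤ L * (y - x)) :
    ∀ a b : ℝ, a ≤ b → Set.Icc a b ⊆ ⋃ i ∈ s, C i → |g b - g a| ≤ L * (b - a) := by
  classical
  induction s using Finset.induction_on with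
  | empty =>
    intro a b hab h
    exact absurd (h (Set.left_mem_Icc.2 hab)) (by simp)
  | insert i s hi ih =>
    intro a b hab h
    have hC' : ∀ j ∈ s, IsClosed (C j) := fun j hj => hC j (Finset.mem_insert_of_mem hj)
    have ih' := ih hC' (fun j hj => hL j (Finset.mem_insert_of_mem hj))
    have hcl : IsClosed (⋃ j ∈ s, C j) := s.finite_toSet.isClosed_biUnion hC'
    have hK : IsCompact (C i ∩ Set.Icc a b) :=
      isCompact_Icc.inter_left (hC i (Finset.mem_insert_self _ _))
    rcases (C i ∩ Set.Icc a b).eq_empty_or_nonempty with he | hne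
    · refine ih' a b hab fun x hx => ?_
      have := h hx
      simp only [Finset.mem_insert, Set.iUnion_iUnion_eq_or_left, Set.mem_union] at this
      rcases this with h1 | h1
      · exact absurd (show x ∈ C i ∩ Set.Icc a b from ⟨h1, hx⟩) (by simp [he])
      · exact h1
    · obtain ⟨p, ⟨hp, hpab⟩, hpl⟩ := hK.exists_isLeast hne
      obtain ⟨q, ⟨hq, hqab⟩, hql⟩ := hK.exists_isGreatest hne
      have hpq : p ≤ q := hpl ⟨hq, hqab⟩
      have h1 : |g p - g a| ≤ L * (p - a) := by
        rcases hpab.1.eq_or_lt with rfl | hlt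
        · simp
        · refine ih' a p hpab.1 ?_
          rw [← closure_Ico hlt.ne]
          refine hcl.closure_subset_iff.2 fun x hx => ?_
          have hx' : x ∈ Set.Icc a b := ⟨hx.1, hx.2.le.trans hpab.2⟩
          have := h hx'
          -- The half-open interval before `p` misses `C i`; the remaining union is closed, so it
          -- also contains the endpoint `p`.
          simp only [Finset.mem_insert, Set.iUnion_iUnion_eq_or_left, Set.mem_union] at this
          exact this.resolve_left fun h1 => absurd (hpl ⟨h1, hx'⟩) (not_le.2 hx.2)
      have h2 : |g b - g q| ≤ L * (b - q) := by
        rcases hqab.2.eq_or_lt with rfl | hlt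
        · simp
        · refine ih' q b hqab.2 ?_
          rw [← closure_Ioc hlt.ne]
          refine hcl.closure_subset_iff.2 fun x hx => ?_
          have hx' : x ∈ Set.Icc a b := ⟨hqab.1.trans hx.1.le, hx.2⟩
          have := h hx'
          simp only [Finset.mem_insert, Set.iUnion_iUnion_eq_or_left, Set.mem_union] at this
          exact this.resolve_left fun h1 => absurd (hql ⟨h1, hx'⟩) (not_le.2 hx.1)
      have h3 := hL i (Finset.mem_insert_self _ _) p hp q hq hpq
      calc |g b - g a| = |(g b - g q) + (g q - g p) + (g p - g a)| := by ring_nf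
        _ ≤ |g b - g q| + |g q - g p| + |g p - g a| := abs_add_three _ _ _
        _ ≤ L * (b - a) := by linarith

theorem lipschitzWith_of_finite_closed_cover {E ι : Type*} [NormedAddCommGroup E]
    [NormedSpace ℝ E] (s : Finset ι) (C : ι → Set E) (hC : ∀ i ∈ s, IsClosed (C i))
    (hcov : ∀ x, ∃ i ∈ s, x ∈ C i) (f : E → ℝ) (L : NNReal)
    (hL : ∀ i ∈ s, LipschitzOnWith L f (C i)) : LipschitzWith L f := by
  refine LipschitzWith.of_dist_le_mul fun x y => ?_
  have hcont : Continuous fun t : ℝ => AffineMap.lineMap (k := ℝ) x y t :=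
    AffineMap.lineMap_continuous
  have := abs_sub_le_of_finite_closed_cover s
    (fun i => (fun t : ℝ => AffineMap.lineMap (k := ℝ) x y t) ⁻¹' C i)
    (fun i hi => (hC i hi).preimage hcont)
    (fun t => f (AffineMap.lineMap (k := ℝ) x y t)) (L * dist x y) ?_ 0 1 zero_le_one ?_
  · simpa [dist_comm, Real.dist_eq, abs_sub_comm] using this
  · intro i hi t ht u hu htu
    have h := (hL i hi).dist_le_mul _ hu _ ht
    rw [Real.dist_eq, dist_lineMap_lineMap, Real.dist_eq, abs_of_nonneg (sub_nonneg.2 htu)] at h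
    linarith
  · intro t _
    obtain ⟨i, hi, h⟩ := hcov (AffineMap.lineMap (k := ℝ) x y t)
    exact Set.mem_biUnion (show i ∈ (s : Set ι) from hi) h

/-! ### Facets of a triangulation -/

section Mesh

variable {d : ℕ} {D : Set (EuclideanSpace ℝ (Fin d))}
  {K : SimplicialComplex ℝ (EuclideanSpace ℝ (Fin d))}

theorem IsTriangulation.exists_facet_superset (hK : IsTriangulation D K)
    {s : Finset (EuclideanSpace ℝ (Fin d))} (hs : s ∈ K.faces) : ∃ t ∈ K.facets, s ⊆ t := by
  obtain ⟨t, hst, ht⟩ := hK.finite_faces.exists_le_maximal hs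
  exact ⟨t, ⟨ht.1, fun u hu htu => le_antisymm htu (ht.2 hu htu)⟩, hst⟩

theorem IsTriangulation.exists_facet (hK : IsTriangulation D K) {x : EuclideanSpace ℝ (Fin d)}
    (hx : x ∈ closure D) :
    ∃ s ∈ K.facets, x ∈ convexHull ℝ (s : Set (EuclideanSpace ℝ (Fin d))) := by
  rw [← hK.space_eq, SimplicialComplex.mem_space_iff] at hx
  obtain ⟨s, hs, hxs⟩ := hx
  obtain ⟨t, ht, hst⟩ := hK.exists_facet_superset hs
  exact ⟨t, ht, convexHull_mono (by exact_mod_cast hst) hxs⟩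

theorem IsTriangulation.finite_interiorVertex (hK : IsTriangulation D K) :
    Finite (InteriorVertex D K) := by
  have : K.vertices.Finite := by
    refine (hK.finite_faces.preimage (f := fun x => ({x} : Finset _))
      Finset.singleton_injective.injOn).subset fun x hx => hx
  exact (this.subset fun x hx => hx.1 : {x | x ∈ K.vertices ∧ x ∈ D}.Finite).to_subtype

/-- The space is covered by the facets, where `v` is affine, and by the complement of `D`, where it
vanishes; the latter is the piece labelled `none`. Global Lipschitz continuity gives
differentiability almost everywhere and bounded gradients, which all later integrability arguments
use. -/
theorem exists_lipschitzWith_of_mem_feSpace (hD : IsOpen D) (hK : IsTriangulation D K)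
    {v : EuclideanSpace ℝ (Fin d) → ℝ} (hv : v ∈ feSpace D K) : ∃ L, LipschitzWith L v := by
  classical
  obtain ⟨-, hv0, hvK⟩ := hv
  choose! g hg using hvK
  have hfin : K.facets.Finite := hK.finite_faces.subset SimplicialComplex.facets_subset
  let T : Finset (Option (Finset (EuclideanSpace ℝ (Fin d)))) :=
    insert none (hfin.toFinset.image some)
  let C : Option (Finset (EuclideanSpace ℝ (Fin d))) → Set (EuclideanSpace ℝ (Fin d)) :=
    fun o => o.elim Dᶜ fun s => convexHull ℝ (s : Set (EuclideanSpace ℝ (Fin d)))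
  let lip : Finset (EuclideanSpace ℝ (Fin d)) → NNReal :=
    fun s => ‖LinearMap.toContinuousLinearMap (g s).linear‖₊
  -- The sum serves as a common upper bound for the constants of the individual facets.
  refine ⟨∑ s ∈ hfin.toFinset, lip s, lipschitzWith_of_finite_closed_cover T C ?_ ?_ v _ ?_⟩
  · rintro (_ | s) -
    · exact hD.isClosed_compl
    · exact (s.finite_toSet.isCompact_convexHull ℝ).isClosed
  · intro x
    by_cases hx : x ∈ D
    · obtain ⟨s, hs, hxs⟩ := hK.exists_facet (subset_closure hx)
      exact ⟨some s, by simp [T, hs], hxs⟩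
    · exact ⟨none, by simp [T], hx⟩
  · rintro (_ | s) hs
    · refine LipschitzOnWith.of_dist_le_mul fun x hx y hy => ?_
      rw [hv0 x hx, hv0 y hy, dist_self]
      positivity
    · have hs' : s ∈ K.facets := by simpa [T] using hs
      refine LipschitzOnWith.weaken (K := lip s) ?_
        (Finset.single_le_sum (f := lip) (fun _ _ => zero_le) (hfin.mem_toFinset.2 hs'))
      refine LipschitzOnWith.of_dist_le_mul fun x hx y hy => ?_
      rw [hg s hs' x hx, hg s hs' y hy, dist_eq_norm, ← vsub_eq_sub, ← (g s).linearMap_vsub,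
        dist_eq_norm]
      exact (LinearMap.toContinuousLinearMap (g s).linear).le_opNorm (x - y)

end Mesh

/-! ### Translation estimate -/

theorem enorm_integral_sq_le {α : Type*} [MeasurableSpace α] (μ : Measure α) (w : α → ℝ)
    (hw : AEMeasurable w μ) :
    ‖∫ t, w t ∂μ‖ₑ ^ 2 ≤ (∫⁻ t, ‖w t‖ₑ ^ 2 ∂μ) * μ Set.univ := by
  have h := ENNReal.lintegral_mul_le_Lp_mul_Lq μ
    Real.HolderConjugate.two_two (f := fun t => ‖w t‖ₑ) (g := fun _ => 1)
    hw.enorm aemeasurable_const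
  simp only [Pi.mul_def, mul_one, one_pow, lintegral_const, one_mul, ENNReal.rpow_two] at h
  calc ‖∫ t, w t ∂μ‖ₑ ^ 2 ≤ (∫⁻ t, ‖w t‖ₑ ∂μ) ^ 2 := by
        gcongr
        exact enorm_integral_le_lintegral_enorm _
    _ ≤ ((∫⁻ t, ‖w t‖ₑ ^ 2 ∂μ) ^ (1 / 2 : ℝ) * μ Set.univ ^ (1 / 2 : ℝ)) ^ 2 := by gcongr
    _ = _ := by
      rw [mul_pow, ← ENNReal.rpow_natCast, ← ENNReal.rpow_natCast, ← ENNReal.rpow_mul,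
        ← ENNReal.rpow_mul]
      norm_num

theorem enorm_sub_sq_le_lintegral_deriv {g : ℝ → ℝ} {L : NNReal} (hg : LipschitzWith L g) :
    ‖g 1 - g 0‖ₑ ^ 2 ≤ ∫⁻ t in Set.Icc (0 : ℝ) 1, ‖deriv g t‖ₑ ^ 2 := by
  have hac : AbsolutelyContinuousOnInterval g 0 1 :=
    (hg.lipschitzOnWith (s := Set.uIcc 0 1)).absolutelyContinuousOnInterval
  rw [← hac.integral_deriv_eq_sub, intervalIntegral.integral_of_le zero_le_one,
    ← integral_Icc_eq_integral_Ioc]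
  simpa using enorm_integral_sq_le (volume.restrict (Set.Icc (0 : ℝ) 1)) (deriv g)
    (measurable_deriv g).aemeasurable

/-- The fundamental theorem of calculus along the segment from `x` to `x + h`, Cauchy–Schwarz on the
unit interval, then Tonelli and translation invariance in `x`. -/
theorem lintegral_enorm_translate_sub_sq_le {E : Type*} [NormedAddCommGroup E]
    [InnerProductSpace ℝ E] [FiniteDimensional ℝ E] [MeasurableSpace E] [BorelSpace E]
    (μ : Measure E) [μ.IsAddHaarMeasure] {v : E → ℝ} {L : NNReal} (hv : LipschitzWith L v)
    (h : E) :
    ∫⁻ x, ‖v (x + h) - v x‖ₑ ^ 2 ∂μ ≤ ‖h‖ₑ ^ 2 * ∫⁻ x, ‖gradient v x‖ₑ ^ 2 ∂μ := by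
  have hmeas : Measurable fun x => ‖lineDeriv ℝ v x h‖ₑ ^ 2 :=
    (measurable_lineDeriv hv.continuous).enorm.pow_const 2
  have hpt : ∀ x, ‖v (x + h) - v x‖ₑ ^ 2 ≤
      ∫⁻ t in Set.Icc (0 : ℝ) 1, ‖lineDeriv ℝ v (x + t • h) h‖ₑ ^ 2 := by
    intro x
    have hl : LipschitzWith (L * ‖h‖₊) fun t : ℝ => v (x + t • h) := by
      refine hv.comp (LipschitzWith.of_dist_le_mul fun t u => ?_)
      rw [dist_add_left, dist_eq_norm, ← sub_smul, norm_smul, dist_eq_norm, mul_comm]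
      rfl
    have := enorm_sub_sq_le_lintegral_deriv hl
    simp only [one_smul, zero_smul, add_zero] at this
    refine this.trans_eq (lintegral_congr fun t => ?_)
    have : deriv (fun s : ℝ => v (x + s • h)) t = lineDeriv ℝ v (x + t • h) h := by
      rw [lineDeriv, ← zero_add t, ← deriv_comp_add_const]
      simp [add_smul, add_assoc, add_comm]
    rw [this]
  calc ∫⁻ x, ‖v (x + h) - v x‖ₑ ^ 2 ∂μ
      ≤ ∫⁻ x, (∫⁻ t in Set.Icc (0 : ℝ) 1, ‖lineDeriv ℝ v (x + t • h) h‖ₑ ^ 2) ∂μ :=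
        lintegral_mono hpt
    _ = ∫⁻ t in Set.Icc (0 : ℝ) 1, ∫⁻ x, ‖lineDeriv ℝ v (x + t • h) h‖ₑ ^ 2 ∂μ := by
        refine lintegral_lintegral_swap (Measurable.aemeasurable ?_)
        exact hmeas.comp (measurable_fst.add (measurable_snd.smul_const h))
    _ = ∫⁻ t in Set.Icc (0 : ℝ) 1, ∫⁻ x, ‖lineDeriv ℝ v x h‖ₑ ^ 2 ∂μ :=
        lintegral_congr fun t =>
          lintegral_add_right_eq_self (fun x => ‖lineDeriv ℝ v x h‖ₑ ^ 2) (t • h)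
    _ = ∫⁻ x, ‖lineDeriv ℝ v x h‖ₑ ^ 2 ∂μ := by simp
    _ ≤ ∫⁻ x, ‖h‖ₑ ^ 2 * ‖gradient v x‖ₑ ^ 2 ∂μ := by
        refine lintegral_mono_ae ?_
        filter_upwards [hv.ae_differentiableAt (μ := μ)] with x hx
        rw [hx.lineDeriv_eq_fderiv, ← mul_pow]
        gcongr
        have h1 : ‖fderiv ℝ v x‖ₑ = ‖gradient v x‖ₑ := by simp [gradient, enorm_eq_nnnorm]
        rw [mul_comm, ← h1]
        exact ContinuousLinearMap.le_opENorm _ _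
    _ = _ := lintegral_const_mul' _ _ (by finiteness)

/-! ### Quasi-interpolation on the coarse mesh -/

theorem measurable_gradient {E : Type*} [NormedAddCommGroup E] [InnerProductSpace ℝ E]
    [CompleteSpace E] [MeasurableSpace E] [BorelSpace E] (v : E → ℝ) :
    Measurable (gradient v) :=
  (InnerProductSpace.toDual ℝ E).symm.continuous.measurable.comp (measurable_fderiv ℝ v)

theorem norm_gradient_le_of_lipschitzWith {E : Type*} [NormedAddCommGroup E]
    [InnerProductSpace ℝ E] [CompleteSpace E] {v : E → ℝ} {L : NNReal}
    (hv : LipschitzWith L v) (x : E) : ‖gradient v x‖ ≤ L := by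
  rw [gradient, LinearIsometryEquiv.norm_map]
  exact norm_fderiv_le_of_lipschitz ℝ hv

theorem setLIntegral_closedBall_le_translate {E : Type*} [NormedAddCommGroup E]
    [MeasurableSpace E] [BorelSpace E] {v : E → ℝ} {x z : E} {H : ℝ} (hxz : dist x z ≤ H)
    (μ : Measure E) [μ.IsAddHaarMeasure] :
    ∫⁻ y in Metric.closedBall z H, ‖v y - v x‖ₑ ^ 2 ∂μ ≤
      ∫⁻ h in Metric.closedBall 0 (2 * H), ‖v (x + h) - v x‖ₑ ^ 2 ∂μ := by
  have hmp := (measurePreserving_add_left μ x).setLIntegral_comp_preimage_emb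
    (MeasurableEquiv.addLeft x).measurableEmbedding (fun y => ‖v y - v x‖ₑ ^ 2)
    (Metric.closedBall x (2 * H))
  have hpre : (fun h => x + h) ⁻¹' Metric.closedBall x (2 * H) = Metric.closedBall 0 (2 * H) := by
    ext h; simp
  rw [hpre] at hmp
  rw [hmp]
  refine lintegral_mono_set (Metric.closedBall_subset_closedBall' ?_)
  rw [dist_comm]
  linarith

/-! ### Convexity of the domain and averages over balls -/

section Geometry

variable {E : Type*} [NormedAddCommGroup E] [InnerProductSpace ℝ E] [FiniteDimensional ℝ E]
  [MeasurableSpace E] [BorelSpace E]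

/-- Outside `closure D` the function vanishes locally, and the frontier of a convex set is null. -/
theorem lintegral_gradient_eq_setLIntegral {D : Set E} (hD : IsOpen D) (hconv : Convex ℝ D)
    {v : E → ℝ} (hv : ∀ x, x ∉ D → v x = 0) (μ : Measure E) [μ.IsAddHaarMeasure] :
    ∫⁻ x, ‖gradient v x‖ₑ ^ 2 ∂μ = ∫⁻ x in D, ‖gradient v x‖ₑ ^ 2 ∂μ := by
  rw [← lintegral_indicator hD.measurableSet]
  refine lintegral_congr_ae ?_
  have h0 : ∀ᵐ x ∂μ, x ∉ frontier D :=
    measure_eq_zero_iff_ae_notMem.1 (hconv.addHaar_frontier μ)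
  filter_upwards [h0] with x hx
  by_cases hxD : x ∈ D
  · simp [hxD]
  · have hcl : x ∉ closure D := fun h => hx ⟨h, by rwa [hD.interior_eq]⟩
    have : v =ᶠ[nhds x] fun _ => 0 := by
      filter_upwards [isClosed_closure.isOpen_compl.mem_nhds hcl] with y hy
      exact hv y fun h => hy (subset_closure h)
    simp [hxD, gradient, this.fderiv_eq]

/-- The reflection `y ↦ z + z - y` preserves the ball and sends its part in `D` outside `D`:
otherwise the midpoint `z` would lie in `D` by convexity. -/
theorem measure_closedBall_le_two_mul_diff {D : Set E} (hconv : Convex ℝ D)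
    (hD : MeasurableSet D) {z : E} (hz : z ∉ D) (R : ℝ) (μ : Measure E) [μ.IsAddHaarMeasure] :
    μ (Metric.closedBall z R) ≤ 2 * μ (Metric.closedBall z R \ D) := by
  have hmp := Measure.measurePreserving_sub_left μ (z + z)
  have hm : MeasurableSet (Metric.closedBall z R \ D) :=
    Metric.isClosed_closedBall.measurableSet.diff hD
  have h1 : μ (Metric.closedBall z R ∩ D) ≤ μ (Metric.closedBall z R \ D) := by
    rw [← hmp.measure_preimage hm.nullMeasurableSet]
    refine measure_mono fun y hy => ⟨?_, fun hy' => hz ?_⟩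
    · have h2 : z + z - y - z = z - y := by abel
      rw [Metric.mem_closedBall, dist_eq_norm, h2, ← dist_eq_norm, dist_comm]
      exact hy.1
    · have := hconv hy.2 hy' (a := 1 / 2) (b := 1 / 2) (by norm_num) (by norm_num) (by norm_num)
      rwa [← smul_add, add_sub_cancel, ← two_smul ℝ, smul_smul, one_div,
        inv_mul_cancel₀ (two_ne_zero' ℝ), one_smul] at this
  rw [← measure_inter_add_sdiff _ hD, two_mul]
  gcongr

/-- The average of `v` over the ball of radius `H` around `z` if `z ∈ D`, and `0` otherwise. -/
noncomputable def localAverage (D : Set E) (H : ℝ) (v : E → ℝ) (μ : Measure E) (z : E) : ℝ :=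
  open Classical in if z ∈ D then ⨍ y in Metric.closedBall z H, v y ∂μ else 0

theorem measure_mul_enorm_sub_localAverage_sq_le {D : Set E} (hD : IsOpen D)
    (hconv : Convex ℝ D) {v : E → ℝ} (hvc : Continuous v) (hv : ∀ x, x ∉ D → v x = 0)
    (μ : Measure E) [μ.IsAddHaarMeasure] {H : ℝ} (hH : 0 < H) {x z : E} (hxz : dist x z ≤ H) :
    μ (Metric.closedBall 0 H) * ‖v x - localAverage D H v μ z‖ₑ ^ 2 ≤
      2 * ∫⁻ h in Metric.closedBall 0 (2 * H), ‖v (x + h) - v x‖ₑ ^ 2 ∂μ := by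
  have hball : μ (Metric.closedBall 0 H) = μ (Metric.closedBall z H) := by
    rw [Measure.addHaar_closedBall_center μ z H]
  have hpos : μ (Metric.closedBall z H) ≠ 0 := (Metric.measure_closedBall_pos μ z hH).ne'
  have hfin : μ (Metric.closedBall z H) ≠ ⊤ := measure_closedBall_lt_top.ne
  have htr := setLIntegral_closedBall_le_translate (v := v) hxz μ
  rw [hball]
  by_cases hz : z ∈ D
  · rw [localAverage, if_pos hz]
    have hint : IntegrableOn v (Metric.closedBall z H) μ :=
      hvc.continuousOn.integrableOn_compact (isCompact_closedBall z H)
    -- Cauchy–Schwarz for the mean of `v y - v x` over the ball; one factor of the ball's measure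
    -- cancels afterwards.
    have h1 := enorm_integral_sq_le (μ.restrict (Metric.closedBall z H)) (fun y => v y - v x)
      (by fun_prop)
    have h2 : ∫ y in Metric.closedBall z H, (v y - v x) ∂μ =
        μ.real (Metric.closedBall z H) * ((⨍ y in Metric.closedBall z H, v y ∂μ) - v x) := by
      rw [integral_sub hint (integrableOn_const hfin), setIntegral_const, setAverage_eq,
        smul_eq_mul, smul_eq_mul, mul_sub, ← mul_assoc, mul_inv_cancel₀, one_mul]
      exact ENNReal.toReal_ne_zero.2 ⟨hpos, hfin⟩
    rw [h2, Measure.restrict_apply_univ, enorm_mul, mul_pow, measureReal_def,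
      Real.enorm_of_nonneg ENNReal.toReal_nonneg, ENNReal.ofReal_toReal hfin, pow_two, mul_assoc,
      mul_comm (∫⁻ t in _, _ ∂μ), ENNReal.mul_le_mul_iff_right hpos hfin, enorm_sub_rev] at h1
    exact h1.trans (htr.trans (le_mul_of_one_le_left' one_le_two))
  -- On the part of the ball outside `D` one has `v y = 0`, so `v x` is itself a difference there,
  -- up to sign. The factor 2 pays for using only this part.
  · rw [localAverage, if_neg hz, sub_zero]
    calc μ (Metric.closedBall z H) * ‖v x‖ₑ ^ 2
        ≤ 2 * μ (Metric.closedBall z H \ D) * ‖v x‖ₑ ^ 2 := by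
          gcongr
          exact measure_closedBall_le_two_mul_diff hconv hD.measurableSet hz H μ
      _ = 2 * ∫⁻ y in Metric.closedBall z H \ D, ‖v y - v x‖ₑ ^ 2 ∂μ := by
          rw [mul_assoc, setLIntegral_congr_fun (g := fun _ => ‖v x‖ₑ ^ 2)
            (Metric.isClosed_closedBall.measurableSet.diff hD.measurableSet), setLIntegral_const,
            mul_comm (‖v x‖ₑ ^ 2)]
          intro y hy
          simp [hv y hy.2]
      _ ≤ _ := by
          exact mul_le_mul_right ((lintegral_mono_set Set.sdiff_subset).trans htr) 2

end Geometry

/-! ### The coarse interpolant and its error -/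

section Mesh

variable {d : ℕ} {D : Set (EuclideanSpace ℝ (Fin d))}
  {K : SimplicialComplex ℝ (EuclideanSpace ℝ (Fin d))}

/-- Each `φ j` is affine on the facet, so the interpolant carries barycentric coordinates through.
Vertices outside `D` have no basis function, which is consistent because `c` vanishes there. -/
theorem IsNodalBasis.sum_smul_apply [Fintype (InteriorVertex D K)]
    {φ : InteriorVertex D K → EuclideanSpace ℝ (Fin d) → ℝ} (hφ : IsNodalBasis D K φ)
    {c : EuclideanSpace ℝ (Fin d) → ℝ} (hc : ∀ z, z ∉ D → c z = 0)
    {s : Finset (EuclideanSpace ℝ (Fin d))} (hs : s ∈ K.facets)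
    {w : EuclideanSpace ℝ (Fin d) → ℝ} (hw0 : ∀ y ∈ s, 0 ≤ w y) (hw1 : ∑ y ∈ s, w y = 1) :
    ∑ j : InteriorVertex D K, c j * φ j (∑ y ∈ s, w y • y) = ∑ y ∈ s, w y * c y := by
  classical
  have hmem : ∑ y ∈ s, w y • y ∈ convexHull ℝ (s : Set (EuclideanSpace ℝ (Fin d))) :=
    Finset.mem_convexHull'.2 ⟨w, hw0, hw1, rfl⟩
  have haff : ∀ j, φ j (∑ y ∈ s, w y • y) = ∑ y ∈ s, w y * φ j y := by
    intro j
    obtain ⟨g, hg⟩ := (hφ j).1.2.2 s hs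
    have hgs : ∀ y ∈ s, w y * φ j y = w y * g y := fun y hy => by
      rw [hg y (subset_convexHull ℝ _ hy)]
    rw [hg _ hmem, Finset.sum_congr rfl hgs, AffineMap.decomp g]
    simp only [Pi.add_apply, map_sum, map_smul, smul_eq_mul, mul_add, Finset.sum_add_distrib,
      ← Finset.sum_mul, hw1, one_mul]
  simp only [haff, Finset.mul_sum]
  rw [Finset.sum_comm]
  refine Finset.sum_congr rfl fun y hy => ?_
  by_cases hyD : y ∈ D
  · have hyv : y ∈ K.vertices := by
      rw [SimplicialComplex.vertices_eq]
      exact Set.mem_biUnion hs.1 hy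
    have : ∀ j : InteriorVertex D K, φ j y = if j = ⟨y, hyv, hyD⟩ then 1 else 0 :=
      fun j => (hφ j).2 ⟨y, hyv, hyD⟩
    simp [this, mul_comm]
  · simp [hc y hyD, (hφ _).1.2.1 y hyD]

/-- The interpolant at `x` is a convex combination of values of `c` at the vertices of an element
containing `x`, so its deviation from `b` is at most that of the worst vertex. -/
theorem exists_enorm_sub_interpolant_le [Fintype (InteriorVertex D K)] {δ H : ℝ}
    (hK : IsTriangulation D K) (hreg : IsRegularMesh K δ H)
    {φ : InteriorVertex D K → EuclideanSpace ℝ (Fin d) → ℝ} (hφ : IsNodalBasis D K φ)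
    {c : EuclideanSpace ℝ (Fin d) → ℝ} (hc : ∀ z, z ∉ D → c z = 0)
    {x : EuclideanSpace ℝ (Fin d)} (hx : x ∈ D) (b : ℝ) :
    ∃ z, dist x z ≤ H ∧ ‖b - ∑ j : InteriorVertex D K, c j * φ j x‖ₑ ≤ ‖b - c z‖ₑ := by
  obtain ⟨s, hs, hxs⟩ := hK.exists_facet (subset_closure hx)
  obtain ⟨w, hw0, hw1, hwx⟩ := Finset.mem_convexHull'.1 hxs
  have hne : s.Nonempty := SimplicialComplex.nonempty_of_mem_faces hs.1
  obtain ⟨z, hz, hmax⟩ := s.exists_max_image (fun y => |b - c y|) hne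
  refine ⟨z, ?_, ?_⟩
  · exact (Metric.dist_le_diam_of_mem (s.finite_toSet.isCompact_convexHull ℝ).isBounded hxs
      (subset_convexHull ℝ _ hz)).trans (hreg s hs).1
  · rw [Real.enorm_eq_ofReal_abs, Real.enorm_eq_ofReal_abs]
    refine ENNReal.ofReal_le_ofReal ?_
    rw [← hwx, hφ.sum_smul_apply hc hs hw0 hw1]
    calc |b - ∑ y ∈ s, w y * c y| = |∑ y ∈ s, w y * (b - c y)| := by
          simp only [mul_sub, Finset.sum_sub_distrib, ← Finset.sum_mul, hw1, one_mul]
      _ ≤ ∑ y ∈ s, |w y * (b - c y)| := Finset.abs_sum_le_sum_abs _ _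
      _ ≤ ∑ y ∈ s, w y * |b - c z| := by
          refine Finset.sum_le_sum fun y hy => ?_
          rw [abs_mul, abs_of_nonneg (hw0 y hy)]
          exact mul_le_mul_of_nonneg_left (hmax y hy) (hw0 y hy)
      _ = |b - c z| := by rw [← Finset.sum_mul, hw1, one_mul]

theorem lintegral_sub_interpolant_sq_le [Fintype (InteriorVertex D K)] {δ H : ℝ} (hH : 0 < H)
    (hD : IsOpen D) (hconv : Convex ℝ D)
    (hK : IsTriangulation D K) (hreg : IsRegularMesh K δ H)
    {φ : InteriorVertex D K → EuclideanSpace ℝ (Fin d) → ℝ} (hφ : IsNodalBasis D K φ)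
    {v : EuclideanSpace ℝ (Fin d) → ℝ} {L : NNReal} (hvL : LipschitzWith L v)
    (hv : ∀ x, x ∉ D → v x = 0) :
    ∫⁻ x in D, ‖v x - ∑ j : InteriorVertex D K, localAverage D H v volume j * φ j x‖ₑ ^ 2 ≤
      ENNReal.ofReal (2 ^ (d + 3) * H ^ 2) * ∫⁻ x in D, ‖gradient v x‖ₑ ^ 2 := by
  set m : ENNReal := volume (Metric.closedBall (0 : EuclideanSpace ℝ (Fin d)) H) with hm
  have hpos : m ≠ 0 := (Metric.measure_closedBall_pos volume _ hH).ne'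
  have hfin : m ≠ ⊤ := measure_closedBall_lt_top.ne
  have hc : ∀ z, z ∉ D → localAverage D H v volume z = 0 := fun z hz => if_neg hz
  have hvc := hvL.continuous
  rw [← ENNReal.mul_le_mul_iff_right hpos hfin, ← lintegral_const_mul' _ _ hfin]
  have hvol : volume (Metric.closedBall (0 : EuclideanSpace ℝ (Fin d)) (2 * H)) =
      ENNReal.ofReal (2 ^ d) * m := by
    rw [Measure.addHaar_closedBall_mul volume _ zero_le_two hH.le, finrank_euclideanSpace_fin]
  calc ∫⁻ x in D, m * ‖v x - ∑ j : InteriorVertex D K, localAverage D H v volume j * φ j x‖ₑ ^ 2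
      ≤ ∫⁻ x in D, 2 * ∫⁻ h in Metric.closedBall 0 (2 * H), ‖v (x + h) - v x‖ₑ ^ 2 := by
        refine setLIntegral_mono' hD.measurableSet fun x hx => ?_
        obtain ⟨z, hxz, hz⟩ := exists_enorm_sub_interpolant_le hK hreg hφ hc hx (v x)
        refine le_trans ?_
          (measure_mul_enorm_sub_localAverage_sq_le hD hconv hvc hv volume hH hxz)
        gcongr
    -- The `x`-integral is enlarged to the whole space, where translation invariance is available.
    _ ≤ ∫⁻ x, 2 * ∫⁻ h in Metric.closedBall 0 (2 * H), ‖v (x + h) - v x‖ₑ ^ 2 :=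
        setLIntegral_le_lintegral _ _
    _ = 2 * ∫⁻ h in Metric.closedBall 0 (2 * H), ∫⁻ x, ‖v (x + h) - v x‖ₑ ^ 2 := by
        rw [lintegral_const_mul' _ _ (by finiteness), lintegral_lintegral_swap]
        exact Measurable.aemeasurable (by fun_prop)
    _ ≤ 2 * ∫⁻ _ in Metric.closedBall (0 : EuclideanSpace ℝ (Fin d)) (2 * H),
          ENNReal.ofReal (2 * H) ^ 2 * ∫⁻ x, ‖gradient v x‖ₑ ^ 2 := by
        gcongr 2 * ?_
        refine setLIntegral_mono' Metric.isClosed_closedBall.measurableSet fun h hh => ?_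
        refine (lintegral_enorm_translate_sub_sq_le volume hvL h).trans ?_
        gcongr
        rw [← ofReal_norm]
        exact ENNReal.ofReal_le_ofReal (by simpa using hh)
    _ = _ := by
        rw [setLIntegral_const, hvol, lintegral_gradient_eq_setLIntegral hD hconv hv]
        -- The constant collects 2 from the half-ball argument, `2 ^ d` from the volume ratio of the
        -- balls, and `(2 * H) ^ 2` from the largest translation.
        have h2 : ENNReal.ofReal (2 ^ (d + 3) * H ^ 2) =
            2 * (ENNReal.ofReal (2 * H) ^ 2 * ENNReal.ofReal (2 ^ d)) := by
          rw [← ENNReal.ofReal_pow (by positivity), ← ENNReal.ofReal_mul (by positivity),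
            ← ENNReal.ofReal_ofNat 2, ← ENNReal.ofReal_mul zero_le_two]
          congr 1
          ring
        rw [h2]
        ring

end Mesh

/-! ### Poincaré inequality for functions orthogonal to the coarse space -/

theorem Continuous.integrableOn_of_isBounded {E : Type*} [NormedAddCommGroup E] [ProperSpace E]
    [MeasurableSpace E] [BorelSpace E] {μ : Measure E} [IsFiniteMeasureOnCompacts μ] {g : E → ℝ}
    (hg : Continuous g) {D : Set E} (hD : Bornology.IsBounded D) : IntegrableOn g D μ :=
  (hg.continuousOn.integrableOn_compact hD.isCompact_closure).mono_set subset_closure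

theorem sq_integral_mul_le {α : Type*} [MeasurableSpace α] {μ : Measure α} {f g : α → ℝ}
    (hf : MemLp f 2 μ) (hg : MemLp g 2 μ) :
    (∫ x, f x * g x ∂μ) ^ 2 ≤ (∫ x, f x ^ 2 ∂μ) * ∫ x, g x ^ 2 ∂μ := by
  have hf2 := hf.integrable_sq
  have hg2 := hg.integrable_sq
  have hfg : Integrable (fun x => f x * g x) μ := hf.integrable_mul hg
  have h := discrim_le_zero (a := ∫ x, f x ^ 2 ∂μ) (b := 2 * ∫ x, f x * g x ∂μ)
    (c := ∫ x, g x ^ 2 ∂μ) fun t => by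
      have : ∫ x, (t * f x + g x) ^ 2 ∂μ = (∫ x, f x ^ 2 ∂μ) * (t * t) +
          2 * (∫ x, f x * g x ∂μ) * t + ∫ x, g x ^ 2 ∂μ := by
        rw [← integral_mul_const, ← integral_const_mul, ← integral_mul_const,
          ← integral_add (hf2.mul_const _) ((hfg.const_mul 2).mul_const t),
          ← integral_add]
        · exact integral_congr_ae (.of_forall fun x => by ring)
        · exact (hf2.mul_const _).add ((hfg.const_mul 2).mul_const t)
        · exact hg2
      rw [← this]
      exact integral_nonneg fun x => sq_nonneg _
  rw [discrim] at h
  nlinarith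

theorem eLpNorm_two_toReal_sq {α : Type*} [MeasurableSpace α] {μ : Measure α} {f : α → ℝ}
    (hf : MemLp f 2 μ) : (eLpNorm f 2 μ).toReal ^ 2 = ∫ x, f x ^ 2 ∂μ := by
  have h := hf.eLpNorm_eq_integral_rpow_norm two_ne_zero ENNReal.ofNat_ne_top
  simp only [ENNReal.toReal_ofNat, Real.rpow_two, Real.norm_eq_abs, sq_abs] at h
  have h0 : 0 ≤ ∫ x, f x ^ 2 ∂μ := integral_nonneg fun x => sq_nonneg _
  rw [h, ENNReal.toReal_ofReal (by positivity), ← Real.rpow_natCast, ← Real.rpow_mul h0]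
  norm_num

section Mesh

variable {d : ℕ} {D : Set (EuclideanSpace ℝ (Fin d))}
  {K : SimplicialComplex ℝ (EuclideanSpace ℝ (Fin d))}

theorem integrableOn_norm_gradient_sq (hb : Bornology.IsBounded D)
    {v : EuclideanSpace ℝ (Fin d) → ℝ} {L : NNReal} (hv : LipschitzWith L v) :
    IntegrableOn (fun x => ‖gradient v x‖ ^ 2) D := by
  refine Measure.integrableOn_of_bounded (M := (L : ℝ) ^ 2) hb.measure_lt_top.ne
    ((measurable_gradient v).norm.pow_const 2).aestronglyMeasurable (.of_forall fun x => ?_)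
  rw [norm_pow, norm_norm]
  exact pow_le_pow_left₀ (norm_nonneg _) (norm_gradient_le_of_lipschitzWith hv x) 2

/-- By Pythagoras, orthogonality of `v` to the interpolant `vH` bounds the norm of `v` by that of `v
- vH`. -/
theorem integral_sq_le_of_orthogonal_nodalBasis {δ H : ℝ} (hH : 0 < H)
    (hD : IsOpen D) (hconv : Convex ℝ D) (hb : Bornology.IsBounded D)
    (hK : IsTriangulation D K) (hreg : IsRegularMesh K δ H)
    {φ : InteriorVertex D K → EuclideanSpace ℝ (Fin d) → ℝ} (hφ : IsNodalBasis D K φ)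
    {v : EuclideanSpace ℝ (Fin d) → ℝ} {L : NNReal} (hvL : LipschitzWith L v)
    (hv : ∀ x, x ∉ D → v x = 0) (horth : ∀ j, ∫ x in D, v x * φ j x = 0) :
    ∫ x in D, v x ^ 2 ≤ 2 ^ (d + 3) * H ^ 2 * ∫ x in D, ‖gradient v x‖ ^ 2 := by
  have := hK.finite_interiorVertex
  have := Fintype.ofFinite (InteriorVertex D K)
  set c := localAverage D H v volume
  have hvc := hvL.continuous
  have hφc : ∀ j, Continuous (φ j) := fun j => (hφ j).1.1
  set vH : EuclideanSpace ℝ (Fin d) → ℝ := fun x => ∑ j : InteriorVertex D K, c j * φ j x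
    with hvH
  have hvHc : Continuous vH := by fun_prop
  have hint : ∀ g : EuclideanSpace ℝ (Fin d) → ℝ, Continuous g → IntegrableOn g D :=
    fun g hg => hg.integrableOn_of_isBounded hb
  have hcross : ∫ x in D, v x * vH x = 0 := by
    have : ∀ x, v x * vH x = ∑ j : InteriorVertex D K, c j * (v x * φ j x) := fun x => by
      rw [hvH, Finset.mul_sum]
      exact Finset.sum_congr rfl fun j _ => by ring
    simp only [this]
    rw [integral_finsetSum _ fun j _ => hint _ (by fun_prop)]
    exact Finset.sum_eq_zero fun j _ => by rw [integral_const_mul, horth, mul_zero]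
  have hexp : ∫ x in D, (v x - vH x) ^ 2 = (∫ x in D, v x ^ 2) + ∫ x in D, vH x ^ 2 := by
    have h1 : ∀ x, (v x - vH x) ^ 2 = v x ^ 2 + vH x ^ 2 - 2 * (v x * vH x) := fun x => by ring
    simp only [h1]
    rw [integral_sub (hint _ (by fun_prop)) (hint _ (by fun_prop)),
      integral_add (hint _ (by fun_prop)) (hint _ (by fun_prop)), integral_const_mul, hcross]
    ring
  have hle := lintegral_sub_interpolant_sq_le hH hD hconv hK hreg hφ hvL hv
  have e1 : ∀ t : ℝ, ‖t‖ₑ ^ 2 = ENNReal.ofReal (t ^ 2) := fun t => by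
    rw [Real.enorm_eq_ofReal_abs, ← ENNReal.ofReal_pow (abs_nonneg t), sq_abs]
  have e2 : ∀ x, ‖gradient v x‖ₑ ^ 2 = ENNReal.ofReal (‖gradient v x‖ ^ 2) := fun x => by
    rw [← ofReal_norm, ENNReal.ofReal_pow (norm_nonneg _)]
  simp only [e1, e2] at hle
  rw [← ofReal_integral_eq_lintegral_ofReal (hint _ (by fun_prop))
      (.of_forall fun x => sq_nonneg _),
    ← ofReal_integral_eq_lintegral_ofReal (integrableOn_norm_gradient_sq hb hvL)
      (.of_forall fun x => sq_nonneg _), ← ENNReal.ofReal_mul (by positivity),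
    ENNReal.ofReal_le_ofReal_iff (mul_nonneg (by positivity)
      (integral_nonneg fun x => sq_nonneg _))] at hle
  have h0 : 0 ≤ ∫ x in D, vH x ^ 2 := integral_nonneg fun x => sq_nonneg _
  linarith [hexp.symm.trans_le hle]

theorem sq_integral_mul_le_of_orthogonal_nodalBasis {δ H : ℝ} (hH : 0 < H)
    (hD : IsOpen D) (hconv : Convex ℝ D) (hb : Bornology.IsBounded D)
    (hK : IsTriangulation D K) (hreg : IsRegularMesh K δ H)
    {φ : InteriorVertex D K → EuclideanSpace ℝ (Fin d) → ℝ} (hφ : IsNodalBasis D K φ)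
    {v : EuclideanSpace ℝ (Fin d) → ℝ} {L : NNReal} (hvL : LipschitzWith L v)
    (hv : ∀ x, x ∉ D → v x = 0) (horth : ∀ j, ∫ x in D, v x * φ j x = 0)
    {f : EuclideanSpace ℝ (Fin d) → ℝ} (hf : MemLp f 2 (volume.restrict D)) :
    (∫ x in D, f x * v x) ^ 2 ≤
      (∫ x in D, f x ^ 2) * (2 ^ (d + 3) * H ^ 2 * ∫ x in D, ‖gradient v x‖ ^ 2) := by
  have hvL2 : MemLp v 2 (volume.restrict D) :=
    (memLp_two_iff_integrable_sq hvL.continuous.aestronglyMeasurable).2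
      ((hvL.continuous.pow 2).integrableOn_of_isBounded hb)
  refine (sq_integral_mul_le hf hvL2).trans ?_
  exact mul_le_mul_of_nonneg_left
    (integral_sq_le_of_orthogonal_nodalBasis hH hD hconv hb hK hreg hφ hvL hv horth)
    (integral_nonneg fun x => sq_nonneg (f x))

/-! ### The energy form for a fixed coefficient -/

/-- The form `∫_D c ∇v · ∇w dx`. -/
noncomputable def pathEnergy (D : Set (EuclideanSpace ℝ (Fin d)))
    (c v w : EuclideanSpace ℝ (Fin d) → ℝ) : ℝ :=
  ∫ x in D, c x * inner ℝ (gradient v x) (gradient w x)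

theorem pathEnergy_comm (c v w : EuclideanSpace ℝ (Fin d) → ℝ) :
    pathEnergy D c v w = pathEnergy D c w v := by
  simp only [pathEnergy, real_inner_comm]

/-- No differentiability is needed: for `t ≠ 0` both sides take the default value zero together, and
for `t = 0` both vanish. -/
theorem gradient_const_mul (t : ℝ) (v : EuclideanSpace ℝ (Fin d) → ℝ)
    (x : EuclideanSpace ℝ (Fin d)) :
    gradient (fun y => t * v y) x = t • gradient v x := by
  have : fderiv ℝ (fun y => t * v y) x = t • fderiv ℝ v x := by
    have := fderiv_const_smul_field (𝕜 := ℝ) (f := v) t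
    simpa [Pi.smul_def] using congrFun this x
  rw [gradient, this, map_smulₛₗ]
  rfl

theorem pathEnergy_const_mul_left (t : ℝ) (c v w : EuclideanSpace ℝ (Fin d) → ℝ) :
    pathEnergy D c (fun y => t * v y) w = t * pathEnergy D c v w := by
  simp only [pathEnergy, gradient_const_mul, real_inner_smul_left]
  rw [← integral_const_mul]
  exact integral_congr_ae (.of_forall fun x => by ring)

variable {c v v' w : EuclideanSpace ℝ (Fin d) → ℝ} {amin amax : ℝ} {L L' M : NNReal}

theorem abs_mul_inner_gradient_le (hamin : 0 ≤ amin) {x : EuclideanSpace ℝ (Fin d)}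
    (hc : c x ∈ Set.Icc amin amax) (hv : LipschitzWith L v) (hw : LipschitzWith M w) :
    ‖c x * inner ℝ (gradient v x) (gradient w x)‖ ≤ amax * (L * M) := by
  have h := (abs_real_inner_le_norm (gradient v x) (gradient w x)).trans
    (mul_le_mul (norm_gradient_le_of_lipschitzWith hv x) (norm_gradient_le_of_lipschitzWith hw x)
      (norm_nonneg _) L.coe_nonneg)
  rw [Real.norm_eq_abs, abs_mul, abs_of_nonneg (hamin.trans hc.1)]
  exact mul_le_mul hc.2 h (abs_nonneg _) (hamin.trans (hc.1.trans hc.2))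

theorem integrableOn_mul_inner_gradient (hD : IsOpen D) (hb : Bornology.IsBounded D)
    (hamin : 0 ≤ amin) (hcm : Measurable c) (hc : ∀ x ∈ D, c x ∈ Set.Icc amin amax)
    (hv : LipschitzWith L v) (hw : LipschitzWith M w) :
    IntegrableOn (fun x => c x * inner ℝ (gradient v x) (gradient w x)) D := by
  refine Measure.integrableOn_of_bounded (M := amax * (L * M)) hb.measure_lt_top.ne
    (hcm.mul ((measurable_gradient v).inner (measurable_gradient w))).aestronglyMeasurable ?_
  filter_upwards [ae_restrict_mem hD.measurableSet] with x hx
  exact abs_mul_inner_gradient_le hamin (hc x hx) hv hw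

theorem abs_pathEnergy_le (hb : Bornology.IsBounded D)
    (hamin : 0 ≤ amin) (hc : ∀ x ∈ D, c x ∈ Set.Icc amin amax)
    (hv : LipschitzWith L v) (hw : LipschitzWith M w) :
    ‖pathEnergy D c v w‖ ≤ amax * (L * M) * volume.real D :=
  norm_setIntegral_le_of_norm_le_const hb.measure_lt_top
    fun x hx => abs_mul_inner_gradient_le hamin (hc x hx) hv hw

/-- The gradient is additive only where both functions are differentiable, which is almost
everywhere by Rademacher's theorem. -/
theorem pathEnergy_add_left (hD : IsOpen D) (hb : Bornology.IsBounded D)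
    (hamin : 0 ≤ amin) (hcm : Measurable c) (hc : ∀ x ∈ D, c x ∈ Set.Icc amin amax)
    (hv : LipschitzWith L v) (hv' : LipschitzWith L' v') (hw : LipschitzWith M w) :
    pathEnergy D c (fun y => v y + v' y) w = pathEnergy D c v w + pathEnergy D c v' w := by
  rw [pathEnergy, pathEnergy, pathEnergy,
    ← integral_add (integrableOn_mul_inner_gradient hD hb hamin hcm hc hv hw)
      (integrableOn_mul_inner_gradient hD hb hamin hcm hc hv' hw)]
  refine integral_congr_ae (ae_restrict_of_ae ?_)
  filter_upwards [hv.ae_differentiableAt (μ := volume), hv'.ae_differentiableAt (μ := volume)]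
    with x hx hx'
  have : gradient (fun y => v y + v' y) x = gradient v x + gradient v' x := by
    rw [gradient, gradient, gradient, ← map_add, ← fderiv_add hx hx']
    rfl
  rw [this, inner_add_left, mul_add]

theorem mul_integral_norm_gradient_sq_le_pathEnergy (hD : IsOpen D) (hb : Bornology.IsBounded D)
    (hamin : 0 ≤ amin) (hcm : Measurable c) (hc : ∀ x ∈ D, c x ∈ Set.Icc amin amax)
    (hv : LipschitzWith L v) :
    amin * ∫ x in D, ‖gradient v x‖ ^ 2 ≤ pathEnergy D c v v := by
  rw [← integral_const_mul]
  refine setIntegral_mono_on ((integrableOn_norm_gradient_sq hb hv).const_mul _)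
    (integrableOn_mul_inner_gradient hD hb hamin hcm hc hv hv) hD.measurableSet fun x hx => ?_
  rw [real_inner_self_eq_norm_sq]
  exact mul_le_mul_of_nonneg_right (hc x hx).1 (sq_nonneg _)

end Mesh

/-! ### Galerkin solutions in spaces of constrained minimizers -/

/-- The quadratic `t ↦ B w w * t ^ 2 + 2 * B u w * t` is nonnegative and has no constant term, so
its discriminant forces `B u w = 0`. -/
theorem inner_eq_zero_of_forall_le {X : Type*} [AddCommGroup X] [Module ℝ X]
    (B : X →ₗ[ℝ] X →ₗ[ℝ] ℝ) (hsymm : ∀ u w, B u w = B w u) {u w : X}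
    (h : ∀ t : ℝ, B u u ≤ B (u + t • w) (u + t • w)) : B u w = 0 := by
  have h1 := discrim_le_zero (a := B w w) (b := 2 * B u w) (c := 0) fun t => by
    have := h t
    simp only [map_add, map_smul, LinearMap.add_apply, LinearMap.smul_apply, smul_eq_mul,
      hsymm w u] at this
    linarith
  rw [discrim] at h1
  nlinarith [sq_nonneg (B u w)]

theorem galerkin_error_le_of_constrained_minimizers {X ι : Type*} [AddCommGroup X] [Module ℝ X]
    [Fintype ι] [DecidableEq ι] (B : X →ₗ[ℝ] X →ₗ[ℝ] ℝ) (hsymm : ∀ u w, B u w = B w u)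
    (ℓ : ι → X →ₗ[ℝ] ℝ) (ψ : ι → X) (hψ : ∀ i j, ℓ j (ψ i) = if i = j then 1 else 0)
    (hmin : ∀ i χ, (∀ j, ℓ j χ = if i = j then 1 else 0) → B (ψ i) (ψ i) ≤ B χ χ)
    (F : X → ℝ) {C : ℝ} (hC : 0 ≤ C) (hF : ∀ w, (∀ j, ℓ j w = 0) → F w ^ 2 ≤ C * B w w)
    {u uH : X} (hu : ∀ w, B u w = F w) (huH : uH ∈ Submodule.span ℝ (Set.range ψ))
    (huH' : ∀ i, B uH (ψ i) = F (ψ i)) : B (u - uH) (u - uH) ≤ C := by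
  have horth : ∀ w, (∀ j, ℓ j w = 0) → ∀ z ∈ Submodule.span ℝ (Set.range ψ), B z w = 0 := by
    intro w hw z hz
    induction hz using Submodule.span_induction with
    | mem z hz =>
      obtain ⟨i, rfl⟩ := hz
      exact inner_eq_zero_of_forall_le B hsymm fun t => hmin i _ fun j => by simp [hw, hψ]
    | zero => simp
    | add y z _ _ hy hz => simp [hy, hz]
    | smul t z _ hz => simp [hz]
  obtain ⟨e, he⟩ : ∃ e, e = u - uH := ⟨_, rfl⟩
  have heψ : ∀ i, B e (ψ i) = 0 := fun i => by simp [he, hu, huH']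
  -- By duality of `ψ` and `ℓ`, this `z` has the constraint values of `e`, so `e - z` lies in the
  -- common kernel.
  set z := ∑ i, ℓ i e • ψ i with hz
  have hzmem : z ∈ Submodule.span ℝ (Set.range ψ) :=
    Submodule.sum_mem _ fun i _ => Submodule.smul_mem _ _ (Submodule.subset_span ⟨i, rfl⟩)
  have hBz : B e z = 0 := by simp [hz, heψ]
  have hconstr : ∀ j, ℓ j (e - z) = 0 := fun j => by simp [hz, hψ]
  have h1 : B e e = B e (e - z) := by rw [map_sub (B e), hBz, sub_zero]
  have h2 : B (e - z) (e - z) = B e (e - z) := by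
    rw [map_sub B, LinearMap.sub_apply, horth _ hconstr z hzmem, sub_zero]
  have h3 : B e (e - z) = F (e - z) := by
    have : ∀ w, B e w = B u w - B uH w := fun w => by rw [he, map_sub, LinearMap.sub_apply]
    rw [this, horth _ hconstr uH huH, sub_zero, hu]
  have h4 := hF _ hconstr
  rw [← he]
  rw [h2, ← h3, ← h1] at h4
  -- At this point `B e e ^ 2 ≤ C * B e e`; if `C < B e e`, then `B e e` is positive because `0 ≤
  -- C`, a contradiction.
  by_contra! h
  nlinarith

/-! ### Orthonormality of the chaos polynomials -/

section Chaos

variable {Ω : Type*} [MeasurableSpace Ω] {P : Measure Ω} {r : ℕ} {ξ : Fin r → Ω → ℝ}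
  {ρ : Measure ℝ} {Q : ℕ → Polynomial ℝ}

theorem measurable_chaosPoly (hξ : ∀ i, Measurable (ξ i)) (α : Fin r → ℕ) :
    Measurable (chaosPoly Q ξ α) :=
  Finset.measurable_fun_prod _ fun i _ =>
    (Polynomial.continuous _).measurable.comp (hξ i)

theorem integral_chaosPoly_mul (hξ : ∀ i, Measurable (ξ i)) (hind : iIndepFun ξ P)
    (hρ : ∀ i, P.map (ξ i) = ρ) (hQ : IsOrthonormalPolynomials ρ Q) (α β : Fin r → ℕ) :
    ∫ ω, chaosPoly Q ξ α ω * chaosPoly Q ξ β ω ∂P = if α = β then 1 else 0 := by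
  classical
  let g : Fin r → ℝ → ℝ := fun i t => (Q (α i)).eval t * (Q (β i)).eval t
  have hg : ∀ i, Continuous (g i) := fun i =>
    (Polynomial.continuous _).mul (Polynomial.continuous _)
  calc ∫ ω, chaosPoly Q ξ α ω * chaosPoly Q ξ β ω ∂P = ∫ ω, ∏ i, g i (ξ i ω) ∂P :=
        integral_congr_ae (.of_forall fun ω => (Finset.prod_mul_distrib).symm)
    _ = ∏ i, ∫ ω, g i (ξ i ω) ∂P :=
        hind.integral_fun_prod_comp (fun i => (hξ i).aemeasurable)
          fun i => (hg i).aestronglyMeasurable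
    _ = ∏ i, if α i = β i then 1 else 0 := by
        refine Finset.prod_congr rfl fun i _ => ?_
        rw [← integral_map (hξ i).aemeasurable (hg i).aestronglyMeasurable, hρ i, hQ.2]
    _ = if α = β then 1 else 0 := by
        rw [Finset.prod_ite_zero, Finset.prod_const_one]
        simp [funext_iff]

theorem memLp_chaosPoly (hξ : ∀ i, Measurable (ξ i)) (hind : iIndepFun ξ P)
    (hρ : ∀ i, P.map (ξ i) = ρ) (hQ : IsOrthonormalPolynomials ρ Q) (α : Fin r → ℕ) :
    MemLp (chaosPoly Q ξ α) 2 P := by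
  refine (memLp_two_iff_integrable_sq (measurable_chaosPoly hξ α).aestronglyMeasurable).2 ?_
  -- A non-integrable square would have Bochner integral zero, whereas orthonormality gives one.
  by_contra h
  have h1 := integral_chaosPoly_mul hξ hind hρ hQ α α
  rw [if_pos rfl] at h1
  simp only [← pow_two, integral_undef h, zero_ne_one] at h1

end Chaos

/-! ### Forms on the gPC space -/

section Gpc

variable {d r : ℕ} {Ω : Type*} {Q : ℕ → Polynomial ℝ}
  {ξ : Fin r → Ω → ℝ} {J : Finset (Fin r → ℕ)} {D : Set (EuclideanSpace ℝ (Fin d))}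
  {K : SimplicialComplex ℝ (EuclideanSpace ℝ (Fin d))}
  {u u' w : EuclideanSpace ℝ (Fin d) → Ω → ℝ}

theorem gpcSpace_induction {V : Submodule ℝ (EuclideanSpace ℝ (Fin d) → ℝ)}
    {p : (EuclideanSpace ℝ (Fin d) → Ω → ℝ) → Prop}
    (mul : ∀ v ∈ V, ∀ α ∈ J, p fun x ω => v x * chaosPoly Q ξ α ω)
    (zero : p fun _ _ => 0)
    (add : ∀ u ∈ gpcSpace V Q ξ J, ∀ u' ∈ gpcSpace V Q ξ J, p u → p u' →
      p fun x ω => u x ω + u' x ω)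
    (smul : ∀ (t : ℝ), ∀ u ∈ gpcSpace V Q ξ J, p u → p fun x ω => t * u x ω)
    {u : EuclideanSpace ℝ (Fin d) → Ω → ℝ} (hu : u ∈ gpcSpace V Q ξ J) : p u := by
  induction hu using Submodule.span_induction with
  | mem z hz =>
    obtain ⟨v, hv, α, hα, rfl⟩ := hz
    exact mul v hv α hα
  | zero => exact zero
  | add y z hy hz ihy ihz => exact add y hy z hz ihy ihz
  | smul t z hz ihz => exact smul t z hz ihz

theorem apply_mem_of_mem_gpcSpace {V : Submodule ℝ (EuclideanSpace ℝ (Fin d) → ℝ)}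
    (hu : u ∈ gpcSpace V Q ξ J) (ω : Ω) : (fun x => u x ω) ∈ V := by
  refine gpcSpace_induction (p := fun u => (fun x => u x ω) ∈ V) ?_ ?_ ?_ ?_ hu
  · intro v hv α _
    simp only [mul_comm (v _)]
    exact V.smul_mem (chaosPoly Q ξ α ω) hv
  · exact V.zero_mem
  · exact fun u _ u' _ h h' => V.add_mem h h'
  · exact fun t u _ h => V.smul_mem t h

variable [MeasurableSpace Ω] {P : Measure Ω} {ρ : Measure ℝ}
  {a : EuclideanSpace ℝ (Fin d) → Ω → ℝ} {amin amax : ℝ}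

theorem energyForm_eq_integral_pathEnergy : energyForm P D a u w =
    ∫ ω, pathEnergy D (fun x => a x ω) (fun x => u x ω) (fun x => w x ω) ∂P := rfl

theorem ae_pathEnergy_add (hD : IsOpen D) (hb : Bornology.IsBounded D) (hK : IsTriangulation D K)
    (hamin : 0 ≤ amin) (ham : Measurable (Function.uncurry a))
    (hab : ∀ᵐ ω ∂P, ∀ x ∈ D, a x ω ∈ Set.Icc amin amax)
    (hu : u ∈ gpcSpace (feSpace D K) Q ξ J) (hu' : u' ∈ gpcSpace (feSpace D K) Q ξ J)
    (hw : w ∈ gpcSpace (feSpace D K) Q ξ J) :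
    ∀ᵐ ω ∂P, pathEnergy D (fun x => a x ω) (fun x => u x ω + u' x ω) (fun x => w x ω) =
      pathEnergy D (fun x => a x ω) (fun x => u x ω) (fun x => w x ω) +
      pathEnergy D (fun x => a x ω) (fun x => u' x ω) (fun x => w x ω) := by
  filter_upwards [hab] with ω hω
  obtain ⟨_, h1⟩ := exists_lipschitzWith_of_mem_feSpace hD hK (apply_mem_of_mem_gpcSpace hu ω)
  obtain ⟨_, h2⟩ := exists_lipschitzWith_of_mem_feSpace hD hK (apply_mem_of_mem_gpcSpace hu' ω)
  obtain ⟨_, h3⟩ := exists_lipschitzWith_of_mem_feSpace hD hK (apply_mem_of_mem_gpcSpace hw ω)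
  exact pathEnergy_add_left hD hb hamin (ham.comp measurable_prodMk_right) hω h1 h2 h3

theorem aestronglyMeasurable_pathEnergy [SFinite P] (ham : Measurable (Function.uncurry a))
    (v w : EuclideanSpace ℝ (Fin d) → ℝ) :
    AEStronglyMeasurable (fun ω => pathEnergy D (fun x => a x ω) v w) P := by
  have h : Measurable fun p : Ω × EuclideanSpace ℝ (Fin d) =>
      a p.2 p.1 * inner ℝ (gradient v p.2) (gradient w p.2) :=
    (ham.comp measurable_swap).mul
      (((measurable_gradient v).inner (measurable_gradient w)).comp measurable_snd)
  exact (h.stronglyMeasurable.integral_prod_right' (ν := volume.restrict D)).aestronglyMeasurable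

/-- Reduces integrability to elementary tensors in one argument; by symmetry it is applied to each
argument in turn. -/
theorem integrable_pathEnergy_of_forall_mul (hD : IsOpen D) (hb : Bornology.IsBounded D)
    (hK : IsTriangulation D K) (hamin : 0 ≤ amin) (ham : Measurable (Function.uncurry a))
    (hab : ∀ᵐ ω ∂P, ∀ x ∈ D, a x ω ∈ Set.Icc amin amax)
    (hw : w ∈ gpcSpace (feSpace D K) Q ξ J)
    (hmul : ∀ v ∈ feSpace D K, ∀ α ∈ J, Integrable (fun ω => pathEnergy D (fun x => a x ω)
      (fun x => v x * chaosPoly Q ξ α ω) (fun x => w x ω)) P)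
    (hu : u ∈ gpcSpace (feSpace D K) Q ξ J) :
    Integrable (fun ω => pathEnergy D (fun x => a x ω) (fun x => u x ω) (fun x => w x ω)) P := by
  refine gpcSpace_induction (p := fun u => Integrable (fun ω => pathEnergy D (fun x => a x ω)
    (fun x => u x ω) (fun x => w x ω)) P) hmul ?_ ?_ ?_ hu
  · simp [pathEnergy, gradient]
  · intro u hu u' hu' h h'
    exact (h.add h').congr ((ae_pathEnergy_add hD hb hK hamin ham hab hu hu' hw).mono
      fun ω hω => hω.symm)
  · intro t u _ h
    simp only [pathEnergy_const_mul_left]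
    exact h.const_mul t

theorem integrable_pathEnergy [IsProbabilityMeasure P] (hD : IsOpen D)
    (hb : Bornology.IsBounded D) (hK : IsTriangulation D K)
    (hξ : ∀ i, Measurable (ξ i)) (hind : iIndepFun ξ P)
    (hρ : ∀ i, P.map (ξ i) = ρ) (hQ : IsOrthonormalPolynomials ρ Q)
    (hamin : 0 ≤ amin) (ham : Measurable (Function.uncurry a))
    (hab : ∀ᵐ ω ∂P, ∀ x ∈ D, a x ω ∈ Set.Icc amin amax)
    (hu : u ∈ gpcSpace (feSpace D K) Q ξ J) (hw : w ∈ gpcSpace (feSpace D K) Q ξ J) :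
    Integrable (fun ω => pathEnergy D (fun x => a x ω) (fun x => u x ω) (fun x => w x ω)) P := by
  refine integrable_pathEnergy_of_forall_mul hD hb hK hamin ham hab hw (fun v hv α hα => ?_) hu
  have hvα : (fun x ω => v x * chaosPoly Q ξ α ω) ∈ gpcSpace (feSpace D K) Q ξ J :=
    Submodule.subset_span ⟨v, hv, α, hα, rfl⟩
  simp only [pathEnergy_comm _ (fun x => v x * _)]
  refine integrable_pathEnergy_of_forall_mul hD hb hK hamin ham hab hvα (fun v' hv' β _ => ?_) hw
  have h : ∀ ω, pathEnergy D (fun x => a x ω) (fun x => v' x * chaosPoly Q ξ β ω)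
      (fun x => v x * chaosPoly Q ξ α ω) = (chaosPoly Q ξ β * chaosPoly Q ξ α) ω *
        pathEnergy D (fun x => a x ω) v v' := fun ω => by
    simp only [mul_comm (v _), mul_comm (v' _)]
    rw [pathEnergy_const_mul_left, pathEnergy_comm, pathEnergy_const_mul_left, ← mul_assoc]
    rfl
  simp only [h]
  obtain ⟨L, hL⟩ := exists_lipschitzWith_of_mem_feSpace hD hK hv
  obtain ⟨L', hL'⟩ := exists_lipschitzWith_of_mem_feSpace hD hK hv'
  -- For two elementary tensors the energy is a product of two `L²` chaos polynomials, hence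
  -- integrable, times an almost surely bounded factor.
  exact ((memLp_chaosPoly hξ hind hρ hQ β).integrable_mul
    (memLp_chaosPoly hξ hind hρ hQ α)).mul_bdd (aestronglyMeasurable_pathEnergy ham v v')
    (hab.mono fun ω hω => abs_pathEnergy_le hb hamin hω hL hL')

theorem energyForm_comm : energyForm P D a u w = energyForm P D a w u := by
  simp only [energyForm, real_inner_comm]

theorem energyNorm_eq_sqrt_energyForm :
    energyNorm P D a u = Real.sqrt (energyForm P D a u u) := by
  simp only [energyNorm, energyForm, real_inner_self_eq_norm_sq]

theorem energyForm_self_nonneg (hD : IsOpen D) (hamin : 0 ≤ amin)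
    (hab : ∀ᵐ ω ∂P, ∀ x ∈ D, a x ω ∈ Set.Icc amin amax) : 0 ≤ energyForm P D a u u := by
  refine integral_nonneg_of_ae (hab.mono fun ω hω => ?_)
  exact setIntegral_nonneg hD.measurableSet fun x hx =>
    mul_nonneg (hamin.trans (hω x hx).1) real_inner_self_nonneg

theorem energyForm_const_mul_left (t : ℝ) :
    energyForm P D a (fun x ω => t * u x ω) w = t * energyForm P D a u w := by
  simp only [energyForm_eq_integral_pathEnergy, pathEnergy_const_mul_left, integral_const_mul]

theorem energyForm_add_left [IsProbabilityMeasure P] (hD : IsOpen D)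
    (hb : Bornology.IsBounded D) (hK : IsTriangulation D K)
    (hξ : ∀ i, Measurable (ξ i)) (hind : iIndepFun ξ P)
    (hρ : ∀ i, P.map (ξ i) = ρ) (hQ : IsOrthonormalPolynomials ρ Q)
    (hamin : 0 ≤ amin) (ham : Measurable (Function.uncurry a))
    (hab : ∀ᵐ ω ∂P, ∀ x ∈ D, a x ω ∈ Set.Icc amin amax)
    (hu : u ∈ gpcSpace (feSpace D K) Q ξ J) (hu' : u' ∈ gpcSpace (feSpace D K) Q ξ J)
    (hw : w ∈ gpcSpace (feSpace D K) Q ξ J) :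
    energyForm P D a (fun x ω => u x ω + u' x ω) w =
      energyForm P D a u w + energyForm P D a u' w := by
  simp only [energyForm_eq_integral_pathEnergy]
  rw [← integral_add (integrable_pathEnergy hD hb hK hξ hind hρ hQ hamin ham hab hu hw)
    (integrable_pathEnergy hD hb hK hξ hind hρ hQ hamin ham hab hu' hw)]
  exact integral_congr_ae (ae_pathEnergy_add hD hb hK hamin ham hab hu hu' hw)

theorem integrableOn_mul_of_mem_feSpace (hb : Bornology.IsBounded D)
    {v g : EuclideanSpace ℝ (Fin d) → ℝ} (hg : MemLp g 2 (volume.restrict D))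
    (hv : v ∈ feSpace D K) : IntegrableOn (fun x => v x * g x) D :=
  MemLp.integrable_mul ((memLp_two_iff_integrable_sq hv.1.aestronglyMeasurable).2
    ((hv.1.pow 2).integrableOn_of_isBounded hb)) hg

theorem memLp_integral_mul (hb : Bornology.IsBounded D)
    (hξ : ∀ i, Measurable (ξ i)) (hind : iIndepFun ξ P)
    (hρ : ∀ i, P.map (ξ i) = ρ) (hQ : IsOrthonormalPolynomials ρ Q)
    {g : EuclideanSpace ℝ (Fin d) → ℝ} (hg : MemLp g 2 (volume.restrict D))
    (hu : u ∈ gpcSpace (feSpace D K) Q ξ J) :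
    MemLp (fun ω => ∫ x in D, u x ω * g x) 2 P := by
  refine gpcSpace_induction (p := fun u => MemLp (fun ω => ∫ x in D, u x ω * g x) 2 P)
    ?_ ?_ ?_ ?_ hu
  · intro v _ α _
    simp only [mul_comm (v _), mul_assoc, integral_const_mul]
    exact (memLp_chaosPoly hξ hind hρ hQ α).mul_const _
  · simp
  · intro u hu u' hu' h h'
    simp only [add_mul]
    refine (h.add h').ae_eq (.of_forall fun ω => ?_)
    exact (integral_add (integrableOn_mul_of_mem_feSpace hb hg (apply_mem_of_mem_gpcSpace hu ω))
      (integrableOn_mul_of_mem_feSpace hb hg (apply_mem_of_mem_gpcSpace hu' ω))).symm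
  · intro t u _ h
    simp only [mul_assoc, integral_const_mul]
    exact h.const_mul t

theorem l2Form_mul_chaosPoly (g : EuclideanSpace ℝ (Fin d) → ℝ) (l : Fin r → ℕ) :
    l2Form P D u (fun x ω => g x * chaosPoly Q ξ l ω) =
      ∫ ω, (∫ x in D, u x ω * g x) * chaosPoly Q ξ l ω ∂P := by
  simp only [l2Form, ← mul_assoc, integral_mul_const]

theorem l2Form_const_mul_left (t : ℝ) :
    l2Form P D (fun x ω => t * u x ω) w = t * l2Form P D u w := by
  simp only [l2Form, mul_assoc, integral_const_mul]

theorem l2Form_add_left (hb : Bornology.IsBounded D)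
    (hξ : ∀ i, Measurable (ξ i)) (hind : iIndepFun ξ P)
    (hρ : ∀ i, P.map (ξ i) = ρ) (hQ : IsOrthonormalPolynomials ρ Q)
    {g : EuclideanSpace ℝ (Fin d) → ℝ} (hg : MemLp g 2 (volume.restrict D)) (l : Fin r → ℕ)
    (hu : u ∈ gpcSpace (feSpace D K) Q ξ J) (hu' : u' ∈ gpcSpace (feSpace D K) Q ξ J) :
    l2Form P D (fun x ω => u x ω + u' x ω) (fun x ω => g x * chaosPoly Q ξ l ω) =
      l2Form P D u (fun x ω => g x * chaosPoly Q ξ l ω) +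
      l2Form P D u' (fun x ω => g x * chaosPoly Q ξ l ω) := by
  have hl := memLp_chaosPoly hξ hind hρ hQ l
  have hi : ∀ u ∈ gpcSpace (feSpace D K) Q ξ J,
      Integrable (fun ω => (∫ x in D, u x ω * g x) * chaosPoly Q ξ l ω) P := fun u hu =>
    (memLp_integral_mul hb hξ hind hρ hQ hg hu).integrable_mul hl
  simp only [l2Form_mul_chaosPoly]
  rw [← integral_add (hi u hu) (hi u' hu')]
  refine integral_congr_ae (.of_forall fun ω => ?_)
  simp only [add_mul]
  rw [integral_add (integrableOn_mul_of_mem_feSpace hb hg (apply_mem_of_mem_gpcSpace hu ω))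
    (integrableOn_mul_of_mem_feSpace hb hg (apply_mem_of_mem_gpcSpace hu' ω)), add_mul]

/-- This turns orthogonality in the mean over `ω` into orthogonality at each `ω`. Both sides are
linear in `u`, and for an elementary tensor with index `α` orthonormality leaves only the term `l =
α`. -/
theorem integral_mul_eq_sum_l2Form (hb : Bornology.IsBounded D)
    (hξ : ∀ i, Measurable (ξ i)) (hind : iIndepFun ξ P)
    (hρ : ∀ i, P.map (ξ i) = ρ) (hQ : IsOrthonormalPolynomials ρ Q)
    {g : EuclideanSpace ℝ (Fin d) → ℝ} (hg : MemLp g 2 (volume.restrict D))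
    (hu : u ∈ gpcSpace (feSpace D K) Q ξ J) (ω : Ω) :
    ∫ x in D, u x ω * g x =
      ∑ l ∈ J, l2Form P D u (fun x ω => g x * chaosPoly Q ξ l ω) * chaosPoly Q ξ l ω := by
  classical
  refine gpcSpace_induction (p := fun u => ∫ x in D, u x ω * g x =
      ∑ l ∈ J, l2Form P D u (fun x ω => g x * chaosPoly Q ξ l ω) * chaosPoly Q ξ l ω)
    ?_ ?_ ?_ ?_ hu
  · intro v _ α hα
    simp only [l2Form_mul_chaosPoly, mul_comm (v _) (chaosPoly _ _ _ _), mul_assoc, integral_const_mul]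
    have : ∀ l, ∫ ω, chaosPoly Q ξ α ω * ((∫ x in D, v x * g x) * chaosPoly Q ξ l ω) ∂P =
        (∫ x in D, v x * g x) * if α = l then 1 else 0 := fun l => by
      rw [← integral_chaosPoly_mul hξ hind hρ hQ, ← integral_const_mul]
      exact integral_congr_ae (.of_forall fun ω => by ring)
    simp only [this, mul_ite, mul_one, mul_zero, ite_mul, zero_mul, Finset.sum_ite_eq, hα, if_true]
    rw [mul_comm]
  · simp [l2Form]
  · intro u hu u' hu' h h'
    simp only [l2Form_add_left hb hξ hind hρ hQ hg _ hu hu', add_mul, Finset.sum_add_distrib]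
    rw [← h, ← h']
    exact integral_add (integrableOn_mul_of_mem_feSpace hb hg (apply_mem_of_mem_gpcSpace hu ω))
      (integrableOn_mul_of_mem_feSpace hb hg (apply_mem_of_mem_gpcSpace hu' ω))
  · intro t u _ h
    simp only [l2Form_const_mul_left, mul_assoc, integral_const_mul, h, Finset.mul_sum]

theorem sq_l2Form_le_of_orthogonal [IsProbabilityMeasure P] (hD : IsOpen D)
    (hconv : Convex ℝ D) (hb : Bornology.IsBounded D)
    {TH : SimplicialComplex ℝ (EuclideanSpace ℝ (Fin d))} {δ H : ℝ} (hH : 0 < H)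
    (hTH : IsTriangulation D TH) (hreg : IsRegularMesh TH δ H) (hK : IsTriangulation D K)
    {φ : InteriorVertex D TH → EuclideanSpace ℝ (Fin d) → ℝ} (hφ : IsNodalBasis D TH φ)
    (hξ : ∀ i, Measurable (ξ i)) (hind : iIndepFun ξ P)
    (hρ : ∀ i, P.map (ξ i) = ρ) (hQ : IsOrthonormalPolynomials ρ Q)
    (hamin : 0 < amin) (ham : Measurable (Function.uncurry a))
    (hab : ∀ᵐ ω ∂P, ∀ x ∈ D, a x ω ∈ Set.Icc amin amax)
    {f : EuclideanSpace ℝ (Fin d) → ℝ} (hf : MemLp f 2 (volume.restrict D))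
    (hw : w ∈ gpcSpace (feSpace D K) Q ξ J)
    (horth : ∀ j, ∀ l ∈ J, l2Form P D w (fun x ω => φ j x * chaosPoly Q ξ l ω) = 0) :
    l2Form P D (fun x _ => f x) w ^ 2 ≤
      (2 ^ (d + 3) * H ^ 2 * (∫ x in D, f x ^ 2) / amin) * energyForm P D a w w := by
  have hφ2 : ∀ j, MemLp (φ j) 2 (volume.restrict D) := fun j =>
    (memLp_two_iff_integrable_sq (hφ j).1.1.aestronglyMeasurable).2
      (((hφ j).1.1.pow 2).integrableOn_of_isBounded hb)
  have hX := memLp_integral_mul hb hξ hind hρ hQ hf hw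
  -- Jensen's inequality `(E X)² ≤ E X²`, in the form of nonnegative variance.
  have hvar := variance_nonneg (fun ω => ∫ x in D, w x ω * f x) P
  rw [variance_eq_sub hX, sub_nonneg] at hvar
  have hcomm : l2Form P D (fun x _ => f x) w = ∫ ω, (∫ x in D, w x ω * f x) ∂P := by
    simp only [l2Form, mul_comm (f _)]
  rw [hcomm, energyForm_eq_integral_pathEnergy, ← integral_const_mul]
  refine hvar.trans (integral_mono_ae hX.integrable_sq
    ((integrable_pathEnergy hD hb hK hξ hind hρ hQ hamin.le ham hab hw hw).const_mul _) ?_)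
  filter_upwards [hab] with ω hω
  have hmem := apply_mem_of_mem_gpcSpace hw ω
  obtain ⟨L, hL⟩ := exists_lipschitzWith_of_mem_feSpace hD hK hmem
  have h1 := sq_integral_mul_le_of_orthogonal_nodalBasis hH hD hconv hb hTH hreg hφ hL hmem.2.1
    (fun j => by
      rw [integral_mul_eq_sum_l2Form hb hξ hind hρ hQ (hφ2 j) hw]
      exact Finset.sum_eq_zero fun l hl => by rw [horth j l hl, zero_mul]) hf
  have h2 := mul_integral_norm_gradient_sq_le_pathEnergy hD hb hamin.le
    (ham.comp measurable_prodMk_right) hω hL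
  have h3 : 0 ≤ ∫ x in D, f x ^ 2 := integral_nonneg fun x => sq_nonneg _
  simp only [mul_comm (f _)] at h1
  refine h1.trans ?_
  rw [div_mul_eq_mul_div, le_div_iff₀ hamin]
  calc _ = 2 ^ (d + 3) * H ^ 2 * (∫ x in D, f x ^ 2) *
        (amin * ∫ x in D, ‖gradient (fun x => w x ω) x‖ ^ 2) := by ring
    _ ≤ _ := mul_le_mul_of_nonneg_left h2 (by positivity)

end Gpc

theorem mainTheorem4 (d : ℕ) (hd : d = 2 ∨ d = 3) (δ : ℝ) (hδ : 0 < δ) (hδ1 : δ < 1)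
    (amin amax : ℝ) (hamin : 0 < amin) (hamax : amin ≤ amax) :
    ∃ C₂ : ℝ, 0 < C₂ ∧
      -- the domain, the coarse mesh of size `H` with its nodal basis, and the fine mesh
      ∀ (D : Set (EuclideanSpace ℝ (Fin d))), IsOpen D → Convex ℝ D → Bornology.IsBounded D →
        D.Nonempty →
      ∀ (TH Th : SimplicialComplex ℝ (EuclideanSpace ℝ (Fin d))) (H : ℝ), 0 < H →
        IsTriangulation D TH → IsRegularMesh TH δ H → IsTriangulation D Th →
      ∀ (φ : InteriorVertex D TH → EuclideanSpace ℝ (Fin d) → ℝ), IsNodalBasis D TH φ →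
      -- the random parameters, their orthonormal polynomials and the truncated index set
      ∀ (Ω : Type*) [MeasurableSpace Ω] (P : Measure Ω) [IsProbabilityMeasure P]
        (r : ℕ) (ξ : Fin r → Ω → ℝ) (ρ : Measure ℝ), (∀ i, Measurable (ξ i)) → iIndepFun ξ P →
        (∀ i, P.map (ξ i) = ρ) →
      ∀ (Q : ℕ → Polynomial ℝ), IsOrthonormalPolynomials ρ Q →
      ∀ (J : Finset (Fin r → ℕ)),
      -- the coefficient and the right-hand side
      ∀ (A : EuclideanSpace ℝ (Fin d) → (Fin r → ℝ) → ℝ)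
        (a : EuclideanSpace ℝ (Fin d) → Ω → ℝ),
        Measurable (Function.uncurry A) → (∀ x ω, a x ω = A x (fun i => ξ i ω)) →
        (∀ᵐ ω ∂P, ∀ x ∈ D, a x ω ∈ Set.Icc amin amax) →
      ∀ (f : EuclideanSpace ℝ (Fin d) → ℝ), MemLp f 2 (volume.restrict D) →
      -- the multiscale basis functions and the two Galerkin solutions
      ∀ (ψ : InteriorVertex D TH → J → EuclideanSpace ℝ (Fin d) → Ω → ℝ),
        IsMultiscaleBasis P D a (gpcSpace (feSpace D Th) Q ξ J) TH φ Q ξ J ψ →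
      ∀ (uh uH : EuclideanSpace ℝ (Fin d) → Ω → ℝ),
        IsGalerkinSolution P D a f (gpcSpace (feSpace D Th) Q ξ J) uh →
        IsGalerkinSolution P D a f (msSpace ψ) uH →
        energyNorm P D a (fun x ω => uh x ω - uH x ω) ≤
          C₂ * H * (eLpNorm f 2 (volume.restrict D)).toReal := by
  have hd8 : (2 : ℝ) ^ (d + 3) ≤ 64 := by
    rcases hd with rfl | rfl <;> norm_num
  -- The squared error is bounded with the factor `2 ^ (d + 3) / amin`, and `2 ^ (d + 3) ≤ 64 = 8 ^
  -- 2`.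
  refine ⟨8 / Real.sqrt amin, by positivity, ?_⟩
  intro D hD hconv hb _ TH Th H hH hTH hreg hTh φ hφ Ω _ P _ r ξ ρ hξ hind hρ Q hQ J A a hA haA
    hab f hf ψ hψ uh uH huh huH
  classical
  have := hTH.finite_interiorVertex
  have := Fintype.ofFinite (InteriorVertex D TH)
  have ham : Measurable (Function.uncurry a) := by
    have : Function.uncurry a = fun p => Function.uncurry A (p.1, fun i => ξ i p.2) := by
      ext p
      exact haA p.1 p.2
    rw [this]
    exact hA.comp (measurable_fst.prodMk
      (measurable_pi_lambda _ fun i => (hξ i).comp measurable_snd))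
  set W := gpcSpace (feSpace D Th) Q ξ J
  have hφ2 : ∀ j, MemLp (φ j) 2 (volume.restrict D) := fun j =>
    (memLp_two_iff_integrable_sq (hφ j).1.1.aestronglyMeasurable).2
      (((hφ j).1.1.pow 2).integrableOn_of_isBounded hb)
  -- Additivity relies on integrability, which is available on `W`; hence the abstract argument runs
  -- on the subtype `W` rather than on all functions.
  have hadd : ∀ u u' w : W, energyForm P D a (u + u' : W) w =
      energyForm P D a u w + energyForm P D a u' w := fun u u' w =>
    energyForm_add_left hD hb hTh hξ hind hρ hQ hamin.le ham hab u.2 u'.2 w.2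
  have hsmul : ∀ (t : ℝ) (u w : W), energyForm P D a (t • u : W) w =
      t * energyForm P D a u w := fun t u w => energyForm_const_mul_left t
  let B : W →ₗ[ℝ] W →ₗ[ℝ] ℝ := LinearMap.mk₂ ℝ (fun u w => energyForm P D a u w) hadd
    (fun t u w => hsmul t u w)
    (fun u w w' => by
      rw [energyForm_comm, hadd, energyForm_comm, energyForm_comm (u := w'.1)])
    (fun t u w => by rw [energyForm_comm, hsmul, energyForm_comm, smul_eq_mul])
  let ℓ : InteriorVertex D TH × J → W →ₗ[ℝ] ℝ := fun i =>
    { toFun := fun u => l2Form P D u (fun x ω => φ i.1 x * chaosPoly Q ξ i.2 ω)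
      map_add' := fun u u' => l2Form_add_left hb hξ hind hρ hQ (hφ2 i.1) _ u.2 u'.2
      map_smul' := fun t u => l2Form_const_mul_left t }
  let ψ' : InteriorVertex D TH × J → W := fun i => ⟨ψ i.1 i.2, (hψ i.1 i.2).1.1⟩
  -- `msSpace ψ` is a span in the ambient function space; it is the image of the corresponding span
  -- inside `W`.
  have hspan : ∀ z ∈ msSpace ψ, ∃ h : z ∈ W, (⟨z, h⟩ : W) ∈ Submodule.span ℝ (Set.range ψ') := by
    intro z hz
    have hmap : msSpace ψ = (Submodule.span ℝ (Set.range ψ')).map W.subtype := by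
      rw [Submodule.map_span, msSpace]
      congr 1
      ext z
      constructor
      · rintro ⟨i, k, rfl⟩
        exact ⟨ψ' (i, k), ⟨(i, k), rfl⟩, rfl⟩
      · rintro ⟨_, ⟨⟨i, k⟩, rfl⟩, rfl⟩
        exact ⟨i, k, rfl⟩
    rw [hmap] at hz
    obtain ⟨y, hy, rfl⟩ := hz
    exact ⟨y.2, hy⟩
  obtain ⟨huHW, huHspan⟩ := hspan uH huH.1
  have hF0 : 0 ≤ ∫ x in D, f x ^ 2 := integral_nonneg fun x => sq_nonneg _
  have key := galerkin_error_le_of_constrained_minimizers B (fun u w => energyForm_comm) ℓ ψ'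
    (fun i j => by
      simp only [Prod.ext_iff]
      exact (hψ i.1 i.2).1.2 j.1 j.2)
    (fun i χ hχ => by
      have hfeas : (χ : EuclideanSpace ℝ (Fin d) → Ω → ℝ) ∈
          msFeasible P D W TH φ Q ξ J i.1 i.2 :=
        ⟨χ.2, fun j l => by
          have := hχ (j, l)
          simp only [Prod.ext_iff] at this
          exact this⟩
      have h := (hψ i.1 i.2).2 hfeas
      simp only [Set.mem_ofPred_eq, energyNorm_eq_sqrt_energyForm] at h
      exact (Real.sqrt_le_sqrt_iff (energyForm_self_nonneg hD hamin.le hab)).1 h)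
    (fun w => l2Form P D (fun x _ => f x) w)
    (C := 2 ^ (d + 3) * H ^ 2 * (∫ x in D, f x ^ 2) / amin)
    (by positivity)
    (fun w hw => sq_l2Form_le_of_orthogonal hD hconv hb hH hTH hreg hTh hφ hξ hind hρ hQ hamin ham
      hab hf w.2 fun j l hl => hw (j, ⟨l, hl⟩))
    (u := ⟨uh, huh.1⟩) (uH := ⟨uH, huHW⟩) (fun w => huh.2 w w.2) huHspan
    (fun i => huH.2 _ (Submodule.subset_span ⟨i.1, i.2, rfl⟩))
  have key' : energyForm P D a (fun x ω => uh x ω - uH x ω) (fun x ω => uh x ω - uH x ω) ≤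
      2 ^ (d + 3) * H ^ 2 * (∫ x in D, f x ^ 2) / amin := key
  rw [energyNorm_eq_sqrt_energyForm]
  refine Real.sqrt_le_iff.2 ⟨by positivity, key'.trans ?_⟩
  rw [mul_pow, mul_pow, div_pow, Real.sq_sqrt hamin.le, eLpNorm_two_toReal_sq hf]
  calc 2 ^ (d + 3) * H ^ 2 * (∫ x in D, f x ^ 2) / amin
      ≤ 64 * H ^ 2 * (∫ x in D, f x ^ 2) / amin := by gcongr
    _ = _ := by ring
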